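/- Let $q$ be an odd prime power, let $m\ge 2$ be an integer, and put $n=\frac{q^m-1}{2}$. Let $\alpha$ be a primitive element of $\mathbb{F}_{q^m}$ and $\theta=\alpha^2$, a primitive $n$-th root of unity, and let $m_i(x)$ denote the minimal polynomial of $\theta^i$ over $\mathbb{F}_q$. For $2\le\delta\le n$ let $\mathcal{C}_{(q,m,2,\delta)}$ be the narrow-sense BCH code of length $n$ and designed distance $\delta$, i.e. the cyclic code over $\mathbb{F}_q$ corresponding to the ideal of $\mathbb{F}_q[x]/\langle x^n-1\rangle$ generated by $\mathrm{lcm}(m_1(x),m_2(x),\dots,m_{\delta-1}(x))$. For $0\le i\le n-1$ the $q$-cyclotomic coset of $i$ modulo $n$ is $\{iq^j \bmod n : j\ge 0\}$, and its smallest element is its coset leader. Let $\delta_1$ be the largest $q$-cyclotomic coset leader modulo $n$. Then $$\delta_1=\frac{q^m-1-q^{m-1}-q^{\lfloor (m-1)/2\rfloor}}{2},$$ and $\mathcal{C}_{(q,m,2,\delta_1)}$ is a linear code over $\mathbb{F}_q$ with parameters (length, dimension, minimum distance) $\left[\frac{q^m-1}{2},k,\delta_1\right]$, where the following holds. (i)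 If $m$ is odd, then $k=m+1$ and $\mathcal{C}_{(q,m,2,\delta_1)}$ has exactly four nonzero weights. Its weight distribution is | Weight | Frequency | |---|---| | $0$ | $1$ | | $\frac{q^m-q^{m-1}-q^{\frac{m-1}{2}}-1}{2}$ | $\frac{(q-1)(q^m-1)}{2}$ | | $\frac{q^m-q^{m-1}}{2}$ | $q^m-1$ | | $\frac{q^m-q^{m-1}+q^{\frac{m-1}{2}}-1}{2}$ | $\frac{(q-1)(q^m-1)}{2}$ | | $\frac{q^m-1}{2}$ | $q-1$ | (ii) If $m$ is even, then $k=\frac{m}{2}+1$, and if moreover $m\ge 4$ then $\mathcal{C}_{(q,m,2,\delta_1)}$ has exactly three nonzero weights. Its weight distribution (for every even $m\geq 2$) is | Weight | Frequency | |---|---| | $0$ | $1$ | | $\frac{q^m-q^{m-1}-q^{\frac{m}{2}-1}-1}{2}$ | $(q-1)(q^{\frac{m}{2}}-1)$ | | $\frac{(q-1)(q^{m-1}+q^{\frac{m}{2}-1})}{2}$ | $q^{\frac{m}{2}}-1$ | | $\frac{q^m-1}{2}$ | $q-1$ | where for $m=2$ the last two rows have the same weight and their frequencies are to be added. No other weights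 occur. -/

import Mathlib

open Polynomial

/-- The `q`-cyclotomic coset of `i` modulo `n`: all residues `i * q ^ j mod n` in `{0, …, n - 1}`. -/
def cyclotomicCoset (q n i : ℕ) : Set ℕ :=
  {x | ∃ j : ℕ, x = (i * q ^ j) % n}

/-- The coset leaders modulo `n`: the smallest elements of the cosets of `0 ≤ i ≤ n - 1`. -/
def cosetLeaders (q n : ℕ) : Set ℕ :=
  {s | ∃ i : ℕ, i < n ∧ IsLeast (cyclotomicCoset q n i) s}

/-- `lcm (m_b, m_{b+1}, …, m_{b+δ-2})`, where `m_i` is the minimal polynomial of `θ ^ i` over `F`.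
The least common multiple is the monic one. -/
noncomputable def bchGenerator (F : Type*) {E : Type*} [Field F] [Field E] [Algebra F E]
    [DecidableEq F] (θ : E) (δ b : ℕ) : F[X] :=
  letI : NormalizedGCDMonoid F[X] := UniqueFactorizationMonoid.toNormalizedGCDMonoid F[X]
  (Finset.range (δ - 1)).lcm fun j => minpoly F (θ ^ (b + j))

/-- The class of `c_0 + c_1 x + … + c_{n-1} x^{n-1}` in `F[x] / (x ^ n - 1)`,
as an `F`-linear function of `(c_0, …, c_{n-1})`. -/
noncomputable def wordClass (F : Type*) [Field F] (n : ℕ) :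
    (Fin n → F) →ₗ[F] AdjoinRoot (X ^ n - 1 : F[X]) where
  toFun c := AdjoinRoot.mk (X ^ n - 1 : F[X]) (∑ i : Fin n, C (c i) * X ^ (i : ℕ))
  map_add' c d := by
    simp [add_mul, Finset.sum_add_distrib]
  map_smul' a c := by
    simp [Finset.mul_sum, mul_assoc, Algebra.smul_def, AdjoinRoot.algebraMap_eq]

/-- The cyclic code of length `n` over `F` that corresponds to the ideal
generated by `g` in `F[x] / (x ^ n - 1)`. -/
noncomputable def cyclicCode {F : Type*} [Field F] (n : ℕ) (g : F[X]) :
    Submodule F (Fin n → F) :=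
  ((Ideal.span {AdjoinRoot.mk (X ^ n - 1 : F[X]) g}).restrictScalars F).comap (wordClass F n)

/-- The BCH code of length `n = (q ^ m - 1) / lam` and designed distance `δ`, with first zero
`θ ^ b` for `θ = α ^ lam`; here `q = |F|`, `m = [E : F]` and `α` is a primitive element of `E`. -/
noncomputable def bchCode (F : Type*) {E : Type*} [Field F] [Field E] [Algebra F E]
    [DecidableEq F] (α : E) (q m lam δ b : ℕ) : Submodule F (Fin ((q ^ m - 1) / lam) → F) :=
  cyclicCode ((q ^ m - 1) / lam) (bchGenerator F (α ^ lam) δ b)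

/-- The narrow-sense BCH code: `b = 1`. -/
noncomputable def narrowBCHCode (F : Type*) {E : Type*} [Field F] [Field E] [Algebra F E]
    [DecidableEq F] (α : E) (q m lam δ : ℕ) : Submodule F (Fin ((q ^ m - 1) / lam) → F) :=
  bchCode F α q m lam δ 1

/-- `C` has parameters `[n, k, d]`: its length is `n`, its dimension is `k`, and the minimum
Hamming distance of two distinct codewords is `d`. -/
def HasParameters {F : Type*} [Field F] [DecidableEq F] {n : ℕ} (C : Submodule F (Fin n → F))
    (k d : ℕ) : Prop :=
  Module.finrank F C = k ∧
    IsLeast {t : ℕ | ∃ x ∈ C, ∃ y ∈ C, x ≠ y ∧ hammingDist x y = t} d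

/-- The number of codewords of Hamming weight `w`. -/
noncomputable def weightCount {F : Type*} [Field F] [DecidableEq F] {n : ℕ}
    (C : Submodule F (Fin n → F)) (w : ℕ) : ℕ :=
  Set.ncard {c : Fin n → F | c ∈ C ∧ hammingNorm c = w}

/-- The nonzero weights that occur in `C`. -/
def nonzeroWeights {F : Type*} [Field F] [DecidableEq F] {n : ℕ}
    (C : Submodule F (Fin n → F)) : Set ℕ :=
  {w : ℕ | w ≠ 0 ∧ ∃ c ∈ C, hammingNorm c = w}

/-- `C` has the weight distribution listed in the table `T` of pairs (weight, frequency): the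
number of codewords of weight `w` is the sum of the frequencies in the rows of weight `w`
(so it is `0` if there is no such row, and rows of equal weight are added up). -/
def HasWeightDistribution {F : Type*} [Field F] [DecidableEq F] {n : ℕ}
    (C : Submodule F (Fin n → F)) (T : List (ℕ × ℕ)) : Prop :=
  ∀ w : ℕ, weightCount C w = ((T.filter fun r => r.1 = w).map Prod.snd).sum

/-! Write `n = (q ^ m - 1) / 2`. The reflection `s ↦ n - s` turns minimal elements of cosets into
maximal ones, and doubling turns residues mod `n` into even residues mod `q ^ m - 1`, where
multiplication by `q` rotates base-`q` digits. The largest leader thus corresponds to the smallest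
even residue that is maximal among its rotations: two digits 1, placed as evenly as possible
(`two_mul_largest_cosetLeader`).

Since `δ₁` is the largest leader, the only nonzeros of the code are 1 and the conjugates of `θ ^
δ₁`. With `β = θ ^ (-δ₁)` and `K = F(β)`, the code therefore consists of the words `a + Tr (b β ^
t)`, and `(a, b) ∈ F × K` parametrises it bijectively (`range_traceWord`). Weights become numbers of
solutions of trace equations.

For odd `m`, `β` has order `n` and its powers are the nonzero squares of `K`, so one counts
solutions of `Tr (b x ^ 2) = c`. First and second moments over `c`, with invariance under scaling by
squares, determine these counts without Gauss sums (`quadCount_zero`, `exists_quadCount_partition`).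
For even `m`, `K` has degree `m / 2` and the powers of `β` run through all of its nonzero elements
equally often, so linear trace equations suffice. -/

/-! ### The largest coset leader. -/

theorem Nat.two_mul_half_pow_sub_one {q : ℕ} (hodd : Odd q) (m : ℕ) :
    2 * ((q ^ m - 1) / 2) = q ^ m - 1 := by
  obtain ⟨k, hk⟩ := hodd.pow (n := m)
  omega

/-- A maximal even residue under multiplication by `q` modulo `q ^ m - 1` is at least
`q ^ (m - 1) + q ^ ((m - 1) / 2)`. -/
theorem le_of_forall_mul_pow_mod_le {q m v : ℕ} (hq : 3 ≤ q) (hodd : Odd q) (hm : 2 ≤ m)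
    (hv0 : 0 < v) (hev : Even v) (hv : v < q ^ m - 1)
    (hmax : ∀ j, (v * q ^ j) % (q ^ m - 1) ≤ v) :
    q ^ (m - 1) + q ^ ((m - 1) / 2) ≤ v := by
  by_contra! hlt
  have hpm : q ^ m = q ^ (m - 1) * q := by rw [← pow_succ]; congr 1; omega
  have hqpos : 0 < q ^ (m - 1) := by positivity
  -- The top digit is nonzero, since otherwise multiplication by `q` is an increasing shift without
  -- wrap-around.
  have h1 : q ^ (m - 1) ≤ v := by
    by_contra! h
    have := hmax 1
    have hvq : v * q < q ^ m - 1 := by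
      have : (v + 1) * q ≤ q ^ (m - 1) * q := Nat.mul_le_mul_right _ h
      rw [← hpm] at this
      nlinarith [Nat.sub_add_cancel (Nat.one_le_pow m q (by omega))]
    rw [pow_one, Nat.mod_eq_of_lt hvq] at this
    nlinarith
  obtain ⟨w, rfl⟩ := Nat.exists_eq_add_of_le h1
  have hw : w < q ^ ((m - 1) / 2) := by omega
  -- Evenness enters only here: the odd number `q ^ (m - 1)` alone is excluded.
  have hw0 : w ≠ 0 := by
    rintro rfl
    exact (Nat.not_even_iff_odd.2 (hodd.pow (n := m - 1))) (by simpa using hev)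
  have hl := Nat.pow_log_le_self q hw0
  have hl' := Nat.lt_pow_succ_log_self (b := q) (by omega) w
  set l := Nat.log q w
  have hlh : l < (m - 1) / 2 := (Nat.pow_lt_pow_iff_right (a := q) (by omega)).1 (hl.trans_lt hw)
  -- Rotating by `k + 1` places moves the leading digit of `w` from position `l` to position `m -
  -- 1`, and the top digit 1 to position `k`. As `k ≥ (m - 1) / 2`, the result exceeds `q ^ (m - 1)
  -- + w`.
  obtain ⟨k, hk⟩ : ∃ k, m = l + k + 2 := ⟨m - 2 - l, by omega⟩
  have hk2 : (m - 1) / 2 ≤ k := by omega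
  have key : ((q ^ (m - 1) + w) * q ^ (k + 1)) % (q ^ m - 1) = q ^ k + w * q ^ (k + 1) := by
    have e : (q ^ (m - 1) + w) * q ^ (k + 1) = (q ^ k + w * q ^ (k + 1)) + (q ^ m - 1) * q ^ k := by
      have := Nat.sub_add_cancel (Nat.one_le_pow m q (by omega))
      generalize q ^ m - 1 = N at this
      have e1 : q ^ (m - 1) * q ^ (k + 1) = q ^ m * q ^ k := by
        rw [← pow_add, ← pow_add]; congr 1; omega
      rw [add_mul, e1, ← this]; ring
    rw [e, Nat.add_mul_mod_self_left]
    apply Nat.mod_eq_of_lt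
    have : (w + 1) * q ^ (k + 1) ≤ q ^ (l + 1) * q ^ (k + 1) := Nat.mul_le_mul_right _ hl'
    rw [← pow_add, show l + 1 + (k + 1) = m by omega, add_mul, one_mul] at this
    have h2 : q ^ (k + 1) = q ^ k * q := pow_succ _ _
    have h3 : 0 < q ^ k := by positivity
    have h4 : q ^ k * 3 ≤ q ^ k * q := Nat.mul_le_mul_left _ hq
    omega
  have h := hmax (k + 1)
  rw [key] at h
  have h2 : q ^ l * q ^ (k + 1) ≤ w * q ^ (k + 1) := Nat.mul_le_mul_right _ hl
  rw [← pow_add, show l + (k + 1) = m - 1 by omega] at h2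
  have h3 : q ^ ((m - 1) / 2) ≤ q ^ k := Nat.pow_le_pow_right (by omega) hk2
  omega

/-- A rotation by `i > 0` sends the digit 1 from position `m - 1` to `i - 1`, and the other one from
`(m - 1) / 2` to `(m - 1) / 2 + i`, possibly wrapped. In either case the two new positions are, in
some order, at most the old ones. -/
theorem mul_pow_mod_le {q m : ℕ} (hq : 3 ≤ q) (hm : 2 ≤ m) (j : ℕ) :
    ((q ^ (m - 1) + q ^ ((m - 1) / 2)) * q ^ j) % (q ^ m - 1) ≤
      q ^ (m - 1) + q ^ ((m - 1) / 2) := by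
  have h1 := Nat.sub_add_cancel (Nat.one_le_pow m q (by omega))
  have hmod : q ^ m ≡ 1 [MOD q ^ m - 1] :=
    ((Nat.modEq_iff_dvd' (Nat.one_le_pow m q (by omega))).2 dvd_rfl).symm
  have hmono : ∀ {a b : ℕ}, a ≤ b → q ^ a ≤ q ^ b := fun h => Nat.pow_le_pow_right (by omega) h
  have red : (q ^ (m - 1) + q ^ ((m - 1) / 2)) * q ^ j ≡
      (q ^ (m - 1) + q ^ ((m - 1) / 2)) * q ^ (j % m) [MOD q ^ m - 1] := by
    apply Nat.ModEq.mul_left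
    conv_lhs => rw [← Nat.mod_add_div j m, pow_add, pow_mul]
    simpa using (hmod.pow (j / m)).mul_left (q ^ (j % m))
  rw [red]
  have hj : j % m < m := Nat.mod_lt _ (by omega)
  generalize j % m = i at hj
  rcases Nat.eq_zero_or_pos i with rfl | hi
  · simpa using Nat.mod_le _ _
  have e1 : q ^ (m - 1) * q ^ i ≡ q ^ (i - 1) [MOD q ^ m - 1] := by
    rw [← pow_add, show m - 1 + i = m + (i - 1) by omega, pow_add]
    simpa using hmod.mul_right (q ^ (i - 1))
  rcases lt_or_ge ((m - 1) / 2 + i) m with h | h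
  · have e : (q ^ (m - 1) + q ^ ((m - 1) / 2)) * q ^ i ≡ q ^ (i - 1) + q ^ ((m - 1) / 2 + i)
        [MOD q ^ m - 1] := by
      rw [add_mul, ← pow_add q ((m - 1) / 2)]; exact e1.add_right _
    rw [e]
    refine (Nat.mod_le _ _).trans ?_
    have := @hmono (i - 1) ((m - 1) / 2) (by omega)
    have := @hmono ((m - 1) / 2 + i) (m - 1) (by omega)
    omega
  · have e : (q ^ (m - 1) + q ^ ((m - 1) / 2)) * q ^ i ≡
        q ^ (i - 1) + q ^ ((m - 1) / 2 + i - m) [MOD q ^ m - 1] := by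
      rw [add_mul, ← pow_add q ((m - 1) / 2)]
      refine e1.add ?_
      rw [show (m - 1) / 2 + i = m + ((m - 1) / 2 + i - m) by omega, pow_add, Nat.add_sub_cancel_left]
      simpa using hmod.mul_right (q ^ ((m - 1) / 2 + i - m))
    rw [e]
    refine (Nat.mod_le _ _).trans ?_
    have := @hmono (i - 1) (m - 1) (by omega)
    have := @hmono ((m - 1) / 2 + i - m) ((m - 1) / 2) (by omega)
    omega

/-- Negation mod `n` reverses the order of nonzero residues; this exchanges minimal and maximal
coset elements. -/
theorem Nat.sub_mul_mod_add {n s k : ℕ} (hs : s ≤ n) (h : (s * k) % n ≠ 0) :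
    ((n - s) * k) % n + (s * k) % n = n := by
  rcases Nat.eq_zero_or_pos n with rfl | hn
  · simp_all
  have h1 : ((n - s) * k + s * k) % n = 0 := by
    rw [← add_mul, Nat.sub_add_cancel hs]; simp
  rw [Nat.add_mod] at h1
  have h2 := Nat.mod_lt ((n - s) * k) hn
  have h3 := Nat.mod_lt (s * k) hn
  obtain ⟨c, hc⟩ := Nat.dvd_of_mod_eq_zero h1
  have : c = 1 := by
    have : c < 2 := by by_contra! h; nlinarith
    have : c ≠ 0 := by rintro rfl; omega
    omega
  subst this; omega

theorem cyclotomicCoset_mem_of_mem {q n i s : ℕ} (hs : s ∈ cyclotomicCoset q n i) (j : ℕ) :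
    (s * q ^ j) % n ∈ cyclotomicCoset q n i := by
  obtain ⟨l, rfl⟩ := hs
  exact ⟨l + j, by rw [pow_add, ← mul_assoc, Nat.mod_mul_mod]⟩

theorem le_mul_pow_mod_of_mem_cosetLeaders {q n s : ℕ} (hs : s ∈ cosetLeaders q n) (j : ℕ) :
    s ≤ (s * q ^ j) % n := by
  obtain ⟨i, -, h⟩ := hs
  exact h.2 (cyclotomicCoset_mem_of_mem h.1 j)

theorem exists_mem_cosetLeaders {q n i : ℕ} (hi : i < n) :
    ∃ s ∈ cosetLeaders q n, ∃ j, s = (i * q ^ j) % n := by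
  classical
  have hne : (cyclotomicCoset q n i).Nonempty := ⟨_, 0, rfl⟩
  exact ⟨sInf (cyclotomicCoset q n i),
    ⟨i, hi, Nat.sInf_mem hne, fun _ hx => Nat.sInf_le hx⟩, Nat.sInf_mem hne⟩

theorem pow_sub_one_add_pow_lt {q m : ℕ} (hq : 3 ≤ q) (hm : 2 ≤ m) :
    q ^ (m - 1) + q ^ ((m - 1) / 2) < q ^ m - 1 := by
  have hpm : q ^ m = q ^ (m - 1) * q := by rw [← pow_succ]; congr 1; omega
  have h2 : q ^ 1 ≤ q ^ (m - 1) := Nat.pow_le_pow_right (by omega) (by omega)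
  rw [pow_one] at h2
  have h3 : q ^ ((m - 1) / 2) * q ≤ q ^ (m - 1) := by
    rw [← pow_succ]; exact Nat.pow_le_pow_right (by omega) (by omega)
  have : q ^ (m - 1) * 3 ≤ q ^ (m - 1) * q := Nat.mul_le_mul_left _ hq
  have : q ^ ((m - 1) / 2) * 3 ≤ q ^ ((m - 1) / 2) * q := Nat.mul_le_mul_left _ hq
  omega

theorem two_mul_largest_cosetLeader {q m : ℕ} (hq : 3 ≤ q) (hodd : Odd q) (hm : 2 ≤ m) {δ : ℕ}
    (hδ : IsGreatest (cosetLeaders q ((q ^ m - 1) / 2)) δ) :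
    2 * δ + q ^ (m - 1) + q ^ ((m - 1) / 2) + 1 = q ^ m := by
  have hN := Nat.two_mul_half_pow_sub_one hodd m
  have hlt := pow_sub_one_add_pow_lt hq hm
  obtain ⟨u, hu⟩ : Even (q ^ (m - 1) + q ^ ((m - 1) / 2)) := (hodd.pow).add_odd hodd.pow
  have hle1 : q ^ ((m - 1) / 2) > 0 := by positivity
  have hmx := mul_pow_mod_le hq hm
  have hmin := fun v => le_of_forall_mul_pow_mod_le (v := v) hq hodd hm
  rw [add_assoc (2 * δ), hu]
  generalize (q ^ m - 1) / 2 = n at hN hδ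
  simp only [hu, ← hN] at hmx hmin hlt
  have hleader : n - u ∈ cosetLeaders q n := by
    refine ⟨n - u, by omega, ⟨0, by rw [pow_zero, mul_one, Nat.mod_eq_of_lt (by omega)]⟩, ?_⟩
    rintro x ⟨j, rfl⟩
    have h1 := hmx j
    rw [← two_mul, mul_assoc, Nat.mul_mod_mul_left] at h1
    -- Reflection needs an orbit that avoids 0, which holds because `q` is invertible mod `n`.
    have h2 : (u * q ^ j) % n ≠ 0 := by
      have hcop : Nat.Coprime (q ^ j) n := by
        apply Nat.Coprime.pow_left
        have : Nat.Coprime q (q ^ m - 1) := by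
          have h := Nat.coprime_self_sub_left (m := 1) (n := q ^ m) (Nat.one_le_pow _ _ (by omega))
          have h' : Nat.Coprime (q ^ m) (q ^ m - 1) := by simpa [Nat.coprime_comm] using h
          exact Nat.Coprime.coprime_dvd_left (dvd_pow_self q (by omega)) h'
        exact this.coprime_dvd_right (hN ▸ Dvd.intro_left 2 rfl)
      intro h
      have := Nat.le_of_dvd (by omega) ((hcop.symm).dvd_of_dvd_mul_right (Nat.dvd_of_mod_eq_zero h))
      omega
    have := Nat.sub_mul_mod_add (n := n) (s := u) (by omega) h2
    omega
  have h1 : n - u ≤ δ := hδ.2 hleader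
  have hlow := le_mul_pow_mod_of_mem_cosetLeaders hδ.1
  have hδn : δ < n := by
    have := hlow 0
    exact this.trans_lt (Nat.mod_lt _ (by omega))
  -- The reflected and doubled leader is an even residue mod `2 * n`, maximal in its orbit, so it is
  -- bounded below by `2 * u`; this is the upper bound on `δ`.
  have h2 := hmin (2 * (n - δ)) (by omega) (even_two_mul _) (by omega) (fun j => by
    rw [mul_assoc, Nat.mul_mod_mul_left]
    have h0 := hlow j
    have := Nat.sub_mul_mod_add (n := n) (s := δ) (k := q ^ j) hδn.le (by omega)
    omega)
  have := Nat.one_le_pow m q (by omega)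
  omega

/-! ### Cyclic codes through their zeros, and trace words. -/

section Code
variable {F : Type*} [Field F]

/-- The polynomial `c_0 + c_1 x + … + c_{n-1} x^{n-1}` of a word. -/
noncomputable def wordPoly {n : ℕ} (c : Fin n → F) : F[X] := ∑ i : Fin n, C (c i) * X ^ (i : ℕ)

theorem aeval_wordPoly {E : Type*} [Field E] [Algebra F E] {n : ℕ} (c : Fin n → F) (x : E) :
    aeval x (wordPoly c) = ∑ i : Fin n, algebraMap F E (c i) * x ^ (i : ℕ) := by
  simp [wordPoly]

theorem wordPoly_coeff {n : ℕ} (c : Fin n → F) (i : Fin n) : (wordPoly c).coeff i = c i := by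
  simp [wordPoly, coeff_X_pow, Fin.val_inj]

theorem wordPoly_natDegree_lt {n : ℕ} (hn : 0 < n) (c : Fin n → F) : (wordPoly c).natDegree < n := by
  have : (wordPoly c).natDegree ≤ n - 1 :=
    natDegree_sum_le_of_forall_le _ _ fun i _ => (natDegree_C_mul_X_pow_le _ _).trans (by omega)
  omega

theorem mem_cyclicCode_iff {n : ℕ} {g : F[X]} (hg : g ∣ X ^ n - 1) (c : Fin n → F) :
    c ∈ cyclicCode n g ↔ g ∣ wordPoly c := by
  change AdjoinRoot.mk (X ^ n - 1 : F[X]) (wordPoly c) ∈ Ideal.span {AdjoinRoot.mk _ g} ↔ _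
  rw [Ideal.mem_span_singleton]
  constructor
  · rintro ⟨r, hr⟩
    obtain ⟨r, rfl⟩ := AdjoinRoot.mk_surjective r
    rw [← map_mul, AdjoinRoot.mk_eq_mk] at hr
    exact (dvd_iff_dvd_of_dvd_sub (hg.trans hr)).2 (Dvd.intro _ rfl)
  · exact map_dvd _

theorem bchGenerator_dvd_iff {E : Type*} [Field E] [Algebra F E] [DecidableEq F] (θ : E) (δ b : ℕ)
    (p : F[X]) : bchGenerator F θ δ b ∣ p ↔ ∀ j < δ - 1, aeval (θ ^ (b + j)) p = 0 := by
  unfold bchGenerator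
  simp only [Finset.lcm_dvd_iff, Finset.mem_range, minpoly.dvd_iff]

theorem mem_cyclicCode_bchGenerator_iff {E : Type*} [Field E] [Algebra F E] [DecidableEq F]
    {θ : E} {n : ℕ} (hθ : θ ^ n = 1) (δ : ℕ) (c : Fin n → F) :
    c ∈ cyclicCode n (bchGenerator F θ δ 1) ↔
      ∀ j, 1 ≤ j → j < δ → aeval (θ ^ j) (wordPoly c) = 0 := by
  rw [mem_cyclicCode_iff, bchGenerator_dvd_iff]
  · constructor
    · intro h j h1 h2
      simpa [show 1 + (j - 1) = j by omega] using h (j - 1) (by omega)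
    · intro h j hj
      exact h _ (by omega) (by omega)
  · rw [bchGenerator_dvd_iff]
    intro j _
    rw [map_sub, map_pow, aeval_X, map_one, ← pow_mul, mul_comm, pow_mul, hθ, one_pow, sub_self]

theorem sum_fin_pow_eq_zero {E : Type*} [Field E] {x : E} {n : ℕ} (h1 : x ≠ 1) (hn : x ^ n = 1) :
    ∑ i : Fin n, x ^ (i : ℕ) = 0 := by
  rw [Fin.sum_univ_eq_sum_range (fun i => x ^ i), geom_sum_eq h1, hn, sub_self, zero_div]

theorem aeval_pow_card_pow [Fintype F] {E : Type*} [Field E] [Algebra F E] (x : E)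
    (p : F[X]) (k : ℕ) :
    aeval (x ^ Fintype.card F ^ k) p = aeval x p ^ Fintype.card F ^ k := by
  induction k with
  | zero => simp
  | succ k ih =>
    rw [pow_succ, pow_mul, pow_mul, ← ih, ← expand_aeval, FiniteField.expand_card, map_pow]

/-- The powers of `β` span `K`, and the trace form of a separable extension is nondegenerate. -/
theorem eq_zero_of_forall_trace_mul_pow_eq_zero {K : Type*} [Field K] [Algebra F K]
    [FiniteDimensional F K] [Algebra.IsSeparable F K] {β : K} (hgen : Algebra.adjoin F {β} = ⊤)
    {b : K} (h : ∀ t : ℕ, Algebra.trace F K (b * β ^ t) = 0) : b = 0 := by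
  apply (traceForm_nondegenerate F K).1 b
  intro y
  rw [Algebra.traceForm_apply]
  have hy : y ∈ Submodule.span F (Submonoid.closure {β} : Set K) := by
    rw [← Algebra.adjoin_eq_span, hgen]; trivial
  induction hy using Submodule.span_induction with
  | mem x hx =>
    obtain ⟨t, rfl⟩ := Submonoid.mem_closure_singleton.1 hx
    exact h t
  | zero => simp
  | add x z _ _ hx hz => rw [mul_add, map_add, hx, hz, add_zero]
  | smul r x _ hx => rw [mul_smul_comm, map_smul, hx, smul_zero]

/-- The words `a + Tr (b β ^ t)`, for `0 ≤ t < n`. -/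
noncomputable def traceWord (F : Type*) [Field F] {K : Type*} [Field K] [Algebra F K] (n : ℕ)
    (β : K) : F × K →ₗ[F] (Fin n → F) where
  toFun p t := p.1 + Algebra.trace F K (p.2 * β ^ (t : ℕ))
  map_add' p p' := by ext; simp [add_mul]; ring
  map_smul' r p := by ext; simp [mul_add]

theorem traceWord_injective {K : Type*} [Field K] [Algebra F K]
    [FiniteDimensional F K] [Algebra.IsSeparable F K] {β : K} (hgen : Algebra.adjoin F {β} = ⊤)
    {n : ℕ} (hn : (n : F) ≠ 0) (h1 : β ≠ 1) (hβ : β ^ n = 1) :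
    Function.Injective (traceWord F n β) := by
  rw [injective_iff_map_eq_zero]
  rintro ⟨a, b⟩ h
  have h' : ∀ t : Fin n, a + Algebra.trace F K (b * β ^ (t : ℕ)) = 0 := fun t => congrFun h t
  -- Summing over all positions kills the trace part, a full geometric sum, and leaves `n * a = 0`.
  have ha : a = 0 := by
    have := Finset.sum_congr (rfl : (Finset.univ : Finset (Fin n)) = Finset.univ) fun t _ => h' t
    rw [Finset.sum_add_distrib, ← map_sum, ← Finset.mul_sum, sum_fin_pow_eq_zero h1 hβ] at this
    simpa [hn] using this
  subst ha
  have hn0 : 0 < n := Nat.pos_of_ne_zero (by rintro rfl; simp at hn)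
  have hb : b = 0 := by
    refine eq_zero_of_forall_trace_mul_pow_eq_zero hgen fun t => ?_
    have := h' ⟨t % n, Nat.mod_lt _ hn0⟩
    rw [zero_add] at this
    rw [← Nat.mod_add_div t n, pow_add, pow_mul, hβ, one_pow, mul_one, this]
  rw [hb]; rfl

/-! ### The BCH code as a trace code. -/

section Tower
variable {K E : Type*} [Field K] [Algebra F K] [Field E] [Algebra F E] [Algebra K E]
  [IsScalarTower F K E]

theorem IsPrimitiveRoot.pow_mod {M : Type*} [CommMonoid M] {θ : M} {n : ℕ}
    (hθ : IsPrimitiveRoot θ n) (i : ℕ) : θ ^ (i % n) = θ ^ i := by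
  conv_rhs => rw [← Nat.mod_add_div i n, pow_add, pow_mul, hθ.pow_eq_one, one_pow, mul_one]

/-- Expanding the trace as a sum of Frobenius conjugates turns the value at `θ ^ j` into a
combination of geometric sums with ratios `θ ^ j` and `β ^ (q ^ k) * θ ^ j`, where `q = |F|`. All
ratios are `n`-th roots of unity, and none is 1 because `θ ^ j` is not conjugate to `θ ^ δ = β⁻¹`.
-/
theorem aeval_wordPoly_traceWord_eq_zero [Fintype F] [Finite K] {β : K} {θ : E} {n δ : ℕ}
    (hθ : IsPrimitiveRoot θ n) (hβ : algebraMap K E β * θ ^ δ = 1)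
    {j : ℕ} (hj0 : θ ^ j ≠ 1) (hj : ∀ k, θ ^ j ≠ θ ^ (δ * Fintype.card F ^ k)) (p : F × K) :
    aeval (θ ^ j) (wordPoly (traceWord F n β p)) = 0 := by
  have hjn : (θ ^ j) ^ n = 1 := by rw [← pow_mul, mul_comm, pow_mul, hθ.pow_eq_one, one_pow]
  have hδn : (θ ^ δ) ^ n = 1 := by rw [← pow_mul, mul_comm, pow_mul, hθ.pow_eq_one, one_pow]
  have hβn : (algebraMap K E β) ^ n = 1 := by
    have := congrArg (· ^ n) hβ
    simpa [mul_pow, hδn] using this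
  rw [aeval_wordPoly]
  have e : ∀ i : Fin n, algebraMap F E (traceWord F n β p i) * (θ ^ j) ^ (i : ℕ) =
      algebraMap F E p.1 * (θ ^ j) ^ (i : ℕ) +
      ∑ k ∈ Finset.range (Module.finrank F K), algebraMap K E p.2 ^ Fintype.card F ^ k *
        (algebraMap K E β ^ Fintype.card F ^ k * θ ^ j) ^ (i : ℕ) := by
    intro i
    change algebraMap F E (p.1 + Algebra.trace F K (p.2 * β ^ (i : ℕ))) * _ = _
    rw [map_add, IsScalarTower.algebraMap_apply F K E (Algebra.trace F K _),
      FiniteField.algebraMap_trace_eq_sum_pow, map_sum, add_mul, Finset.sum_mul,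
      Nat.card_eq_fintype_card]
    congr 1
    refine Finset.sum_congr rfl fun k _ => ?_
    rw [map_pow, map_mul, map_pow, mul_pow, mul_pow, ← pow_mul (algebraMap K E β),
      ← pow_mul (algebraMap K E β), mul_comm (i : ℕ), mul_assoc]
  rw [Finset.sum_congr rfl fun i _ => e i, Finset.sum_add_distrib, ← Finset.mul_sum,
    sum_fin_pow_eq_zero hj0 hjn, mul_zero, zero_add, Finset.sum_comm]
  refine Finset.sum_eq_zero fun k _ => ?_
  rw [← Finset.mul_sum, sum_fin_pow_eq_zero, mul_zero]
  · intro h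
    have h2 : algebraMap K E β ^ Fintype.card F ^ k * θ ^ (δ * Fintype.card F ^ k) = 1 := by
      rw [pow_mul, ← mul_pow, hβ, one_pow]
    exact hj k (mul_left_cancel₀ (left_ne_zero_of_mul_eq_one h) (h.trans h2.symm))
  · rw [mul_pow, hjn, mul_one, ← pow_mul, mul_comm, pow_mul, hβn, one_pow]

/-- Trace words vanish at `θ ^ j` for `0 < j < δ`, as such `j` lie outside the coset of its least
element `δ`. Equality follows by dimension: a codeword is determined by its values at 1 and at `θ ^
δ`. -/
theorem range_traceWord [Fintype F] [DecidableEq F] [Finite K] {β : K} {θ : E} {n δ : ℕ}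
    (hθ : IsPrimitiveRoot θ n) (hβ : algebraMap K E β * θ ^ δ = 1)
    (hgen : Algebra.adjoin F {β} = ⊤) (hn : (n : F) ≠ 0) (hδ0 : 0 < δ)
    (hδ : IsGreatest (cosetLeaders (Fintype.card F) n) δ) :
    LinearMap.range (traceWord F n β) = cyclicCode n (bchGenerator F θ δ 1) ∧
      Function.Injective (traceWord F n β) := by
  have := Module.Finite.of_finite (R := F) (M := K)
  have hn0 : 0 < n := Nat.pos_of_ne_zero (by rintro rfl; simp at hn)
  have hlow := le_mul_pow_mod_of_mem_cosetLeaders hδ.1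
  have hδn : δ < n := by
    have := hlow 0
    exact this.trans_lt (Nat.mod_lt _ (by omega))
  have hinj : Function.Injective (traceWord F n β) := by
    apply traceWord_injective hgen hn
    · rintro rfl
      have : θ ^ δ = 1 := by simpa using hβ
      exact hθ.pow_ne_one_of_pos_of_lt hδ0.ne' hδn this
    · apply (algebraMap K E).injective
      have h1 : (θ ^ δ) ^ n = 1 := by rw [← pow_mul, mul_comm, pow_mul, hθ.pow_eq_one, one_pow]
      have := congrArg (· ^ n) hβ
      simpa [mul_pow, h1] using this
  refine ⟨?_, hinj⟩
  apply Submodule.eq_of_le_of_finrank_le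
  · rintro _ ⟨p, rfl⟩
    rw [mem_cyclicCode_bchGenerator_iff hθ.pow_eq_one]
    intro j hj1 hj2
    apply aeval_wordPoly_traceWord_eq_zero hθ hβ
    · exact hθ.pow_ne_one_of_pos_of_lt (by omega) (by omega)
    · intro k hk
      rw [← hθ.pow_mod (δ * _)] at hk
      have := hθ.pow_inj (by omega) (Nat.mod_lt _ hn0) hk
      have := hlow k
      omega
  · rw [LinearMap.finrank_range_of_inj hinj]
    -- Evaluation at the two remaining candidates for nonzeros, 1 and `β⁻¹`.
    let f : (Fin n → F) →ₗ[F] F × K :=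
      { toFun := fun c => (∑ i, c i, ∑ i : Fin n, c i • (β⁻¹) ^ (i : ℕ))
        map_add' := fun c d => by ext <;> simp [Finset.sum_add_distrib, add_smul]
        map_smul' := fun r c => by ext <;> simp [Finset.mul_sum, Finset.smul_sum, mul_smul] }
    have hf : ∀ c ∈ cyclicCode n (bchGenerator F θ δ 1), f c = 0 → c = 0 := by
      intro c hc hfc
      rw [mem_cyclicCode_bchGenerator_iff hθ.pow_eq_one] at hc
      have h0 : aeval (θ ^ 0) (wordPoly c) = 0 := by
        rw [aeval_wordPoly]
        have : ∑ i, c i = 0 := congrArg Prod.fst hfc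
        simpa [map_sum] using congrArg (algebraMap F E) this
      have hd : aeval (θ ^ δ) (wordPoly c) = 0 := by
        rw [aeval_wordPoly]
        have h2 : ∑ i : Fin n, c i • (β⁻¹) ^ (i : ℕ) = 0 := congrArg Prod.snd hfc
        have h3 : θ ^ δ = algebraMap K E β⁻¹ := by
          rw [map_inv₀]; exact eq_inv_of_mul_eq_one_right hβ
        have := congrArg (algebraMap K E) h2
        rw [map_sum, map_zero] at this
        rw [← this, h3]
        refine Finset.sum_congr rfl fun i _ => ?_
        rw [Algebra.smul_def, map_mul, map_pow, ← IsScalarTower.algebraMap_apply]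
      -- Every exponent is Frobenius-conjugate to a leader, which is 0, strictly between 0 and `δ`,
      -- or `δ` itself. A polynomial of degree below `n` with `n` distinct roots is then zero.
      have hall : ∀ i < n, aeval (θ ^ i) (wordPoly c) = 0 := by
        intro i hi
        obtain ⟨s, hs, j, hj⟩ := exists_mem_cosetLeaders (q := Fintype.card F) hi
        have h1 : aeval (θ ^ s) (wordPoly c) = 0 := by
          have := hδ.2 hs
          rcases Nat.eq_zero_or_pos s with rfl | h
          · exact h0
          rcases this.lt_or_eq with h' | rfl
          · exact hc s h h'
          · exact hd
        rw [hj, hθ.pow_mod, pow_mul, aeval_pow_card_pow] at h1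
        exact pow_eq_zero_iff (pow_ne_zero _ Fintype.card_ne_zero) |>.1 h1
      have hp : (wordPoly c).map (algebraMap F E) = 0 := by
        apply Polynomial.eq_zero_of_natDegree_lt_card_of_eval_eq_zero (ι := Fin n) _
          (f := fun i => θ ^ (i : ℕ))
        · intro i j hij
          exact Fin.ext (hθ.pow_inj i.2 j.2 hij)
        · intro i
          rw [eval_map_algebraMap]
          exact hall i i.2
        · rw [natDegree_map, Fintype.card_fin]
          exact wordPoly_natDegree_lt hn0 c
      rw [Polynomial.map_eq_zero] at hp
      ext i
      rw [← wordPoly_coeff c i, hp]; rfl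
    apply LinearMap.finrank_le_finrank_of_injective (f := f.domRestrict _)
    rw [injective_iff_map_eq_zero]
    rintro ⟨c, hc⟩ h
    exact Subtype.ext (hf c hc h)

end Tower
end Code

/-! ### Counting solutions of linear and quadratic trace equations. -/

section Counting
open Finset
variable {F K : Type*} [Field F] [Field K] [Fintype K] [Algebra F K]

theorem card_trace_mul_eq [Fintype F] [DecidableEq F] {y : K} (hy : y ≠ 0) (c : F) :
    #{b : K | Algebra.trace F K (b * y) = c} =
      Fintype.card F ^ (Module.finrank F K - 1) := by
  have hfin := Module.Finite.of_finite (R := F) (M := K)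
  let f : K →+ F := (Algebra.trace F K).toAddMonoidHom.comp (AddMonoidHom.mulRight y)
  have hf : ∀ c, c ∈ Set.range f := fun c => by
    obtain ⟨x, hx⟩ := Algebra.trace_surjective F K c
    exact ⟨x * y⁻¹, by
      change Algebra.trace F K (x * y⁻¹ * y) = c
      rw [mul_assoc, inv_mul_cancel₀ hy, mul_one, hx]⟩
  have hcard : ∀ c', #{b : K | f b = c'} = #{b : K | f b = c} := fun c' =>
    AddMonoidHom.card_fiber_eq_of_mem_range f (hf c') (hf c)
  have hsum := card_eq_sum_card_fiberwise (f := f) (s := univ) (t := univ) (fun _ _ => by simp)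
  rw [sum_congr rfl fun c' _ => hcard c', sum_const, smul_eq_mul, card_univ, card_univ,
    Module.card_eq_pow_finrank (K := F)] at hsum
  have hpos := Module.finrank_pos (R := F) (M := K)
  change #{b : K | f b = c} = _
  refine Nat.eq_of_mul_eq_mul_left (Fintype.card_pos (α := F)) ?_
  rw [← hsum, ← pow_succ', Nat.sub_add_cancel hpos]

/-- The number of `x` with `Tr (b x ^ 2) = c`. -/
noncomputable def quadCount [DecidableEq F] (b : K) (c : F) : ℕ :=
  #{x : K | Algebra.trace F K (b * x ^ 2) = c}

theorem sum_quadCount [Fintype F] [DecidableEq F] (b : K) :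
    ∑ c : F, quadCount b c = Fintype.card K :=
  (card_eq_sum_card_fiberwise (f := fun x => Algebra.trace F K (b * x ^ 2)) (s := univ)
    (t := univ) (fun _ _ => by simp)).symm

theorem quadCount_mul_sq [DecidableEq F] {z : K} (hz : z ≠ 0) (b : K) (c : F) :
    quadCount (b * z ^ 2) c = quadCount b c := by
  refine card_equiv (Equiv.mulLeft₀ z hz) fun x => ?_
  simp [mul_pow, mul_assoc]

theorem quadCount_smul [DecidableEq F] {g : F} (hg : g ≠ 0) (b : K) (c : F) :
    quadCount (g • b) (g * c) = quadCount b c := by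
  simp [quadCount, hg]

theorem quadCount_sq_mul [DecidableEq F] {s : F} (hs : s ≠ 0) (b : K) (c : F) :
    quadCount b (s ^ 2 * c) = quadCount b c := by
  rw [← quadCount_smul (pow_ne_zero 2 hs) b c, Algebra.smul_def, map_pow, mul_comm _ b,
    quadCount_mul_sq ((_root_.map_ne_zero _).2 hs)]

theorem sum_card_trace_mul_eq_zero [Fintype F] [DecidableEq F] {f : K → K}
    (hf0 : ∀ x, f x = 0 ↔ x = 0) :
    ∑ x : K, #{y : K | Algebra.trace F K (y * f x) = 0} = Fintype.card K +
      (Fintype.card K - 1) * Fintype.card F ^ (Module.finrank F K - 1) := by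
  classical
  rw [← add_sum_erase _ _ (mem_univ 0), (hf0 0).2 rfl]
  congr 1
  · simp
  · rw [sum_congr rfl fun x hx => card_trace_mul_eq (c := (0 : F))
      (mt (hf0 x).1 (mem_erase.1 hx).1), sum_const, card_erase_of_mem (mem_univ _), card_univ,
      smul_eq_mul]

theorem sum_quadCount_zero [Fintype F] [DecidableEq F] : ∑ b : K, quadCount b (0 : F) = Fintype.card K +
      (Fintype.card K - 1) * Fintype.card F ^ (Module.finrank F K - 1) := by
  rw [← sum_card_trace_mul_eq_zero (F := F) (K := K) (f := fun x => x ^ 2) (by simp)]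
  simp only [quadCount, card_filter]
  exact sum_comm

/-- The second moment counts pairs with `Tr (b (x ^ 2 - y ^ 2)) = 0`. Factoring the difference of
squares and substituting `u = x - y`, `v = u + 2 y` makes the condition `Tr (v b u) = 0`, linear in
`v`. -/
theorem sum_quadCount_sq [Fintype F] [DecidableEq F] (h2 : (2 : K) ≠ 0) {b : K} (hb : b ≠ 0) :
    ∑ c : F, quadCount b c ^ 2 = Fintype.card K +
      (Fintype.card K - 1) * Fintype.card F ^ (Module.finrank F K - 1) := by
  have e1 : ∑ c : F, quadCount b c ^ 2 =
      ∑ y : K, ∑ x : K, if Algebra.trace F K (b * (x ^ 2 - y ^ 2)) = 0 then 1 else 0 := by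
    simp only [quadCount, card_filter, sq (∑ _, _), sum_mul_sum]
    rw [sum_comm]
    refine sum_congr rfl fun y _ => ?_
    rw [sum_comm]
    refine sum_congr rfl fun x _ => ?_
    simp only [mul_sub, map_sub, sub_eq_zero]
    simp [eq_comm]
  have e2 : ∀ y : K, (∑ x : K, if Algebra.trace F K (b * (x ^ 2 - y ^ 2)) = 0 then 1 else 0) =
      ∑ u : K, if Algebra.trace F K ((u + 2 * y) * (b * u)) = 0 then 1 else 0 := by
    intro y
    rw [← Equiv.sum_comp (Equiv.addRight y)]
    refine sum_congr rfl fun u _ => ?_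
    rw [Equiv.coe_addRight, show b * ((u + y) ^ 2 - y ^ 2) = (u + 2 * y) * (b * u) by ring]
  rw [e1, sum_congr rfl fun y _ => e2 y, sum_comm,
    ← sum_card_trace_mul_eq_zero (F := F) (K := K) (f := fun x => b * x) (by simp [hb])]
  refine sum_congr rfl fun u _ => ?_
  rw [card_filter]
  exact Equiv.sum_comp ((Equiv.mulLeft₀ 2 h2).trans (Equiv.addLeft u))
    (fun v => if Algebra.trace F K (v * (b * u)) = 0 then 1 else 0)

theorem isSquare_mul_of_not_isSquare {L : Type*} [Field L] [Finite L] {a b : L}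
    (ha : ¬ IsSquare a) (hb : ¬ IsSquare b) : IsSquare (a * b) := by
  classical
  have := Fintype.ofFinite L
  have ha0 : a ≠ 0 := by rintro rfl; simp at ha
  have hb0 : b ≠ 0 := by rintro rfl; simp at hb
  rw [← quadraticChar_one_iff_isSquare (mul_ne_zero ha0 hb0), map_mul,
    (quadraticChar_neg_one_iff_not_isSquare).2 ha, (quadraticChar_neg_one_iff_not_isSquare).2 hb]
  rfl

/-- The norm of `g` is the odd power `g ^ (2 * h + 1)`; if it is a square, so is `g`. -/
theorem not_isSquare_algebraMap {h : ℕ} (hd : Module.finrank F K = 2 * h + 1) {g : F}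
    (hg : ¬ IsSquare g) : ¬ IsSquare (algebraMap F K g) := by
  rintro ⟨z, hz⟩
  have hg0 : g ≠ 0 := by rintro rfl; simp at hg
  have := congrArg (Algebra.norm F) hz
  rw [Algebra.norm_algebraMap, hd, map_mul] at this
  refine hg ⟨Algebra.norm F z / g ^ h, ?_⟩
  field_simp
  rw [sq (Algebra.norm F z), ← this]; ring

theorem ringChar_ne_two_of_odd [Fintype F] (hodd : Odd (Fintype.card F)) : ringChar F ≠ 2 := fun h => by
  have := FiniteField.even_card_iff_char_two.1 h
  rw [Nat.odd_iff] at hodd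
  omega

/-- The count at 0 is unchanged when `b` is multiplied by a square of `K` or by a scalar of `F`. In
odd degree a nonsquare of `F` stays a nonsquare in `K`, so the count is the same for all `b ≠ 0`,
and the average over `b` gives it. -/
theorem quadCount_zero [Fintype F] [DecidableEq F] (hodd : Odd (Fintype.card F)) {h : ℕ}
    (hd : Module.finrank F K = 2 * h + 1)
    {b : K} (hb : b ≠ 0) : quadCount b (0 : F) = Fintype.card F ^ (2 * h) := by
  classical
  have hchar := ringChar_ne_two_of_odd hodd
  obtain ⟨g, hg⟩ := FiniteField.exists_nonsquare hchar
  have hg0 : g ≠ 0 := by rintro rfl; simp at hg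
  have hgK := not_isSquare_algebraMap (K := K) hd hg
  have key : ∀ b : K, b ≠ 0 → quadCount b (0 : F) = quadCount (1 : K) (0 : F) := by
    have hsq : ∀ b : K, b ≠ 0 → IsSquare b → quadCount b (0 : F) = quadCount (1 : K) (0 : F) := by
      rintro _ hb ⟨z, rfl⟩
      rw [← sq, ← one_mul (z ^ 2), quadCount_mul_sq (left_ne_zero_of_mul hb)]
    intro b hb
    by_cases hs : IsSquare b
    · exact hsq b hb hs
    · rw [← hsq _ _ (isSquare_mul_of_not_isSquare hgK hs), ← Algebra.smul_def,
        ← quadCount_smul hg0 b 0, mul_zero]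
      exact mul_ne_zero ((_root_.map_ne_zero _).2 hg0) hb
  have hsum := sum_quadCount_zero (F := F) (K := K)
  rw [← add_sum_erase _ _ (mem_univ 0),
    sum_congr rfl fun x hx => key x (mem_erase.1 hx).1, sum_const,
    card_erase_of_mem (mem_univ _), card_univ, smul_eq_mul, hd, Nat.add_sub_cancel] at hsum
  have h0 : quadCount (0 : K) (0 : F) = Fintype.card K := by simp [quadCount]
  rw [h0] at hsum
  rw [key b hb]
  have := Fintype.one_lt_card (α := K)
  exact Nat.eq_of_mul_eq_mul_left (by omega) (Nat.add_left_cancel hsum)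

theorem card_nonzero_isSquare_eq [Fintype F] [DecidableEq F] (hchar : ringChar F ≠ 2) :
    #{c : F | c ≠ 0 ∧ IsSquare c} = #{c : F | c ≠ 0 ∧ ¬ IsSquare c} := by
  obtain ⟨g, hg⟩ := FiniteField.exists_nonsquare hchar
  have hg0 : g ≠ 0 := by rintro rfl; simp at hg
  refine card_equiv (Equiv.mulLeft₀ g hg0) fun c => ?_
  simp only [mem_filter, mem_univ, true_and, Equiv.mulLeft₀_apply, mul_ne_zero_iff, hg0, ne_eq,
    not_false_eq_true]
  refine and_congr_right fun hc => ⟨fun h h' => hg ?_, fun h => ?_⟩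
  · simpa [hc] using h'.div h
  · by_contra h'
    exact h (isSquare_mul_of_not_isSquare hg h')

/-- In odd degree, the values `c ≠ 0` split into two halves on which the number of solutions of
`Tr (b x ^ 2) = c` is smaller, respectively larger, than average by `q ^ h`. -/
theorem exists_quadCount_partition [Fintype F] [DecidableEq F] (hodd : Odd (Fintype.card F)) {h : ℕ}
    (hd : Module.finrank F K = 2 * h + 1) {b : K} (hb : b ≠ 0) :
    ∃ S S' : Finset F, Disjoint S S' ∧ S ∪ S' = univ.erase 0 ∧ #S = #S' ∧
      2 * #S = Fintype.card F - 1 ∧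
      (∀ c ∈ S, quadCount b c + Fintype.card F ^ h = Fintype.card F ^ (2 * h)) ∧
      (∀ c ∈ S', quadCount b c = Fintype.card F ^ (2 * h) + Fintype.card F ^ h) := by
  have hchar := ringChar_ne_two_of_odd hodd
  have hcharK : ringChar K ≠ 2 := by rwa [← Algebra.ringChar_eq F K]
  obtain ⟨g, hg⟩ := FiniteField.exists_nonsquare hchar
  have hg0 : g ≠ 0 := by rintro rfl; simp at hg
  -- The count is constant on nonzero squares and on nonsquares. Which class has the smaller value
  -- is left open, hence the existential form.
  set P : Finset F := {c : F | c ≠ 0 ∧ IsSquare c} with hP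
  set M : Finset F := {c : F | c ≠ 0 ∧ ¬ IsSquare c} with hM
  have hPM : Disjoint P M := by
    rw [Finset.disjoint_left]; intro c; simp +contextual [hP, hM]
  have hU : P ∪ M = univ.erase 0 := by
    ext c; simp [hP, hM]; tauto
  have hcard : #P = #M := card_nonzero_isSquare_eq hchar
  have hcard2 : #P + #M = Fintype.card F - 1 := by
    rw [← card_union_of_disjoint hPM, hU, card_erase_of_mem (mem_univ _), card_univ]
  have hTP : ∀ c ∈ P, quadCount b c = quadCount b (1 : F) := by
    intro c hc
    obtain ⟨hc0, s, rfl⟩ := (mem_filter.1 hc).2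
    rw [← sq, ← mul_one (s ^ 2), quadCount_sq_mul (left_ne_zero_of_mul hc0)]
  have hTM : ∀ c ∈ M, quadCount b c = quadCount b g := by
    intro c hc
    obtain ⟨hc0, hcs⟩ := (mem_filter.1 hc).2
    obtain ⟨s, hs⟩ := isSquare_mul_of_not_isSquare hcs hg
    have hs0 : s ≠ 0 := by rintro rfl; simp [hc0, hg0] at hs
    rw [← quadCount_sq_mul (div_ne_zero hs0 hg0) b g]
    congr 1
    field_simp
    rw [sq s, ← hs]
  have hsplit : ∀ f : F → ℕ, ∑ c, f c = f 0 + (∑ c ∈ P, f c + ∑ c ∈ M, f c) := fun f => by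
    rw [← add_sum_erase _ _ (mem_univ 0), ← hU, sum_union hPM]
  have hcK : Fintype.card K = Fintype.card F ^ (2 * h + 1) := by
    rw [Module.card_eq_pow_finrank (K := F), hd]
  have s1 := sum_quadCount (F := F) b
  have s2 := sum_quadCount_sq (F := F) (Ring.two_ne_zero hcharK) hb
  rw [hsplit, sum_congr rfl hTP, sum_congr rfl hTM, sum_const, sum_const, ← hcard,
    quadCount_zero hodd hd hb, hcK, smul_eq_mul, smul_eq_mul] at s1
  rw [hsplit, sum_congr rfl fun c hc => congrArg (· ^ 2) (hTP c hc),
    sum_congr rfl fun c hc => congrArg (· ^ 2) (hTM c hc), sum_const, sum_const, ← hcard,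
    quadCount_zero hodd hd hb, hcK, smul_eq_mul, smul_eq_mul, hd, Nat.add_sub_cancel] at s2
  have hq1 : 1 < Fintype.card F := Fintype.one_lt_card
  have hPpos : 0 < #P := by omega
  have hqP : Fintype.card F = 2 * #P + 1 := by omega
  have hp1 : 1 ≤ Fintype.card F ^ (2 * h + 1) := Nat.one_le_pow _ _ (by omega)
  have hsqr : Fintype.card F ^ (2 * h) = Fintype.card F ^ h * Fintype.card F ^ h := by
    rw [two_mul, pow_add]
  have hsucc : Fintype.card F ^ (2 * h + 1) = Fintype.card F ^ h * Fintype.card F ^ h *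
      Fintype.card F := by rw [pow_succ, hsqr]
  rw [hsucc, hsqr] at s1 s2
  rw [hsucc] at hp1
  rw [hsqr]
  generalize Fintype.card F ^ h = Q at *
  generalize quadCount b (1 : F) = A at *
  generalize quadCount b g = B at *
  -- The first moment gives `A + B`, the second `A ^ 2 + B ^ 2`; together they force `{A, B} = {Q ^
  -- 2 - Q, Q ^ 2 + Q}`.
  have hAB : A + B = 2 * (Q * Q) := by
    rw [hqP] at s1
    apply Nat.eq_of_mul_eq_mul_left hPpos
    linarith
  have hAB2 : A ^ 2 + B ^ 2 = 2 * (Q * Q) ^ 2 + 2 * Q ^ 2 := by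
    rw [hqP] at s2 hp1
    apply Nat.eq_of_mul_eq_mul_left hPpos
    zify [hp1] at s2 ⊢
    linear_combination s2
  have hfin : (A + Q = Q * Q ∧ B = Q * Q + Q) ∨ (B + Q = Q * Q ∧ A = Q * Q + Q) := by
    zify at hAB hAB2 ⊢
    have hB : (B : ℤ) = 2 * (Q * Q) - A := by linear_combination hAB
    rw [hB] at hAB2 ⊢
    have : ((A : ℤ) - Q * Q - Q) * ((A : ℤ) - Q * Q + Q) = 0 := by
      apply mul_left_cancel₀ (two_ne_zero (α := ℤ))
      linear_combination hAB2
    rcases mul_eq_zero.1 this with h' | h'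
    · exact .inr ⟨by linear_combination -h', by linear_combination h'⟩
    · exact .inl ⟨by linear_combination h', by linear_combination -h'⟩
  rcases hfin with ⟨hA, hB⟩ | ⟨hB, hA⟩
  · exact ⟨P, M, hPM, hU, hcard, by omega, fun c hc => by rw [hTP c hc, hA],
      fun c hc => by rw [hTM c hc, hB]⟩
  · exact ⟨M, P, hPM.symm, by rw [union_comm, hU], hcard.symm, by omega,
      fun c hc => by rw [hTM c hc, hB], fun c hc => by rw [hTP c hc, hA]⟩

end Counting

/-! ### From exponents to elements of the field. -/

section Weights
open Finset

theorem card_filter_fin_mul {P : ℕ → Prop} [DecidablePred P] (M N : ℕ)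
    (hP : ∀ k l, P (k + N * l) ↔ P k) :
    #{t : Fin (M * N) | P t} = M * #{t : Fin N | P t} := by
  rw [card_filter, card_filter, ← Equiv.sum_comp finProdFinEquiv, Fintype.sum_prod_type]
  simp [finProdFinEquiv, hP]

variable {F K : Type*} [Field F] [Field K] [Fintype K] [Algebra F K]

theorem card_filter_pow_primitive [DecidableEq K] {P : K → Prop} [DecidablePred P] {β : K} {N : ℕ}
    (hN : Fintype.card K = N + 1) (hβ : IsPrimitiveRoot β N) :
    #{t : Fin N | P (β ^ (t : ℕ))} = #{y : K | y ≠ 0 ∧ P y} := by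
  have hN0 : 0 < N := by have := Fintype.one_lt_card (α := K); omega
  have : NeZero N := ⟨hN0.ne'⟩
  refine card_bij (fun t _ => β ^ (t : ℕ)) ?_ ?_ ?_
  · intro t ht
    simpa [pow_ne_zero _ (hβ.ne_zero hN0.ne')] using ht
  · intro s _ t _ hst
    exact Fin.ext (hβ.pow_inj s.2 t.2 hst)
  · intro y hy
    obtain ⟨hy0, hy⟩ := (mem_filter.1 hy).2
    obtain ⟨i, hi, rfl⟩ := hβ.eq_pow_of_pow_eq_one (ξ := y) (by
      rw [← FiniteField.pow_card_sub_one_eq_one y hy0, hN, Nat.add_sub_cancel])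
    exact ⟨⟨i, hi⟩, by simpa using hy, rfl⟩

/-- Squaring maps the nonzero elements of `K` two-to-one onto the nonzero squares, which are the
powers of `β` by Euler's criterion. -/
theorem two_mul_card_filter_pow_primitive [DecidableEq K] {P : K → Prop} [DecidablePred P] {β : K}
    {N : ℕ} (hchar : ringChar K ≠ 2) (hN : Fintype.card K = 2 * N + 1) (hβ : IsPrimitiveRoot β N) :
    2 * #{t : Fin N | P (β ^ (t : ℕ))} = #{x : K | x ≠ 0 ∧ P (x ^ 2)} := by
  have hN0 : 0 < N := by have := Fintype.one_lt_card (α := K); omega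
  have : NeZero N := ⟨hN0.ne'⟩
  have hβ0 : β ≠ 0 := hβ.ne_zero hN0.ne'
  have hinj : Set.InjOn (fun t : Fin N => β ^ (t : ℕ)) ({t : Fin N | P (β ^ (t : ℕ))} : Finset _) :=
    fun s _ t _ hst => Fin.ext (hβ.pow_inj s.2 t.2 hst)
  rw [← card_image_of_injOn hinj, mul_comm,
    card_eq_sum_card_fiberwise (s := {x : K | x ≠ 0 ∧ P (x ^ 2)}) (f := fun x : K => x ^ 2)
      (t := image (fun t : Fin N => β ^ (t : ℕ)) {t : Fin N | P (β ^ (t : ℕ))})]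
  · symm
    apply sum_const_nat
    intro y hy
    obtain ⟨t, ht, rfl⟩ := mem_image.1 hy
    have hP : P (β ^ (t : ℕ)) := by simpa using ht
    obtain ⟨r, hr⟩ : IsSquare (β ^ (t : ℕ)) := by
      rw [FiniteField.isSquare_iff hchar (pow_ne_zero _ hβ0), hN,
        show (2 * N + 1) / 2 = N by omega, ← pow_mul, mul_comm, pow_mul, hβ.pow_eq_one, one_pow]
    have hr0 : r ≠ 0 := by
      rintro rfl
      exact pow_ne_zero _ hβ0 (hr.trans (mul_zero 0))
    have : ({x ∈ ({x : K | x ≠ 0 ∧ P (x ^ 2)} : Finset K) | x ^ 2 = β ^ (t : ℕ)}) = {r, -r} := by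
      ext x
      simp only [mem_filter, mem_univ, true_and, mem_insert, mem_singleton]
      rw [← sq_eq_sq_iff_eq_or_eq_neg, sq r, ← hr]
      refine ⟨fun h => h.2, fun h => ⟨⟨?_, by rwa [h]⟩, h⟩⟩
      rintro rfl
      exact pow_ne_zero _ hβ0 (by rw [← h]; simp)
    rw [this, card_pair]
    intro h
    have h2 := Ring.two_ne_zero hchar
    exact hr0 ((mul_eq_zero.1 (by linear_combination h : 2 * r = 0)).resolve_left h2)
  · intro x hx
    obtain ⟨hx0, hx⟩ : x ≠ 0 ∧ P (x ^ 2) := by simpa using hx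
    obtain ⟨i, hi, hxi⟩ := hβ.eq_pow_of_pow_eq_one (ξ := x ^ 2) (by
      rw [← FiniteField.pow_card_sub_one_eq_one x hx0, hN, Nat.add_sub_cancel, pow_mul])
    exact mem_coe.2 (mem_image.2 ⟨⟨i, hi⟩, by simpa [hxi] using hx, hxi⟩)

end Weights

theorem traceWord_apply_eq_zero_iff {F K : Type*} [Field F] [Field K] [Algebra F K] {n : ℕ}
    {β : K} (a : F) (b : K) (t : Fin n) :
    traceWord F n β (a, b) t = 0 ↔ Algebra.trace F K (b * β ^ (t : ℕ)) = -a := by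
  rw [eq_neg_iff_add_eq_zero, add_comm]; rfl

/-! ### Weight tables and what they imply. -/

section Table
open Finset
variable {F : Type*} [Field F] [DecidableEq F] {n : ℕ}

theorem weightCount_range [Fintype F] {K : Type*} [Field K] [Fintype K] [Algebra F K]
    {f : F × K →ₗ[F] (Fin n → F)} (hf : Function.Injective f) (w : ℕ) :
    weightCount (LinearMap.range f) w = #{p : F × K | hammingNorm (f p) = w} := by
  have : {c : Fin n → F | c ∈ LinearMap.range f ∧ hammingNorm c = w} =
      f '' (({p : F × K | hammingNorm (f p) = w} : Finset (F × K)) : Set (F × K)) := by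
    ext c
    constructor
    · rintro ⟨⟨p, rfl⟩, h⟩
      exact ⟨p, by simpa using h, rfl⟩
    · rintro ⟨p, h, rfl⟩
      exact ⟨⟨p, rfl⟩, by simpa using h⟩
  rw [weightCount, this, Set.ncard_image_of_injective _ hf, Set.ncard_coe_finset]

/-- The bookkeeping common to both parities of `m`: pairs are split by whether `a` and `b` vanish,
and only the part with both nonzero, recorded by `r`, differs. -/
theorem card_filter_prod_eq [Fintype F] {K : Type*} [Field K] [Fintype K] {W : F × K → ℕ}
    {n₀ w₀ w r : ℕ} (h0 : W (0, 0) = 0) (hn : ∀ a, a ≠ 0 → W (a, 0) = n₀)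
    (hb : ∀ b, b ≠ 0 → W (0, b) = w₀)
    (hab : ∀ b, b ≠ 0 → #{a : F | a ≠ 0 ∧ W (a, b) = w} = r) :
    #{p : F × K | W p = w} = (if 0 = w then 1 else 0) +
      (if n₀ = w then Fintype.card F - 1 else 0) +
      (Fintype.card K - 1) * ((if w₀ = w then 1 else 0) + r) := by
  classical
  have e : ∀ b : K, #{a : F | W (a, b) = w} = (if W (0, b) = w then 1 else 0) +
      #{a : F | a ≠ 0 ∧ W (a, b) = w} := by
    intro b
    rw [card_filter, card_filter, ← add_sum_erase _ _ (mem_univ 0),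
      ← add_sum_erase univ (fun a => if a ≠ 0 ∧ W (a, b) = w then 1 else 0) (mem_univ 0)]
    simp only [ne_eq, not_true_eq_false, false_and, if_false, zero_add]
    congr 1
    refine sum_congr rfl fun a ha => ?_
    simp [(mem_erase.1 ha).1]
  have e0 : #{a : F | a ≠ 0 ∧ W (a, 0) = w} = if n₀ = w then Fintype.card F - 1 else 0 := by
    have : ∀ a : F, (a ≠ 0 ∧ W (a, 0) = w) ↔ (a ≠ 0 ∧ n₀ = w) := fun a =>
      and_congr_right fun ha => by rw [hn a ha]
    simp only [this]
    split_ifs with h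
    · simp [h, filter_ne']
    · simp [h]
  have hsum : #{p : F × K | W p = w} = ∑ b : K, #{a : F | W (a, b) = w} := by
    simp only [card_filter]
    rw [Fintype.sum_prod_type_right]
  rw [hsum, ← add_sum_erase _ _ (mem_univ 0), e, e0, h0]
  congr 1
  rw [sum_congr rfl fun b hb' => (e b).trans (by
    rw [hb b (mem_erase.1 hb').1, hab b (mem_erase.1 hb').1]), sum_const,
    card_erase_of_mem (mem_univ _), card_univ, smul_eq_mul]

theorem HasWeightDistribution.exists_iff [Finite F] {C : Submodule F (Fin n → F)}
    {T : List (ℕ × ℕ)} (h : HasWeightDistribution C T) (hpos : ∀ r ∈ T, 0 < r.2) (w : ℕ) :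
    (∃ c ∈ C, hammingNorm c = w) ↔ ∃ r ∈ T, r.1 = w := by
  have h1 : (∃ c ∈ C, hammingNorm c = w) ↔ weightCount C w ≠ 0 := by
    rw [weightCount, Ne, Set.ncard_eq_zero (Set.toFinite _), ← Ne, ← Set.nonempty_iff_ne_empty]; rfl
  rw [h1, h w, ne_eq, List.sum_eq_zero_iff]
  simp only [List.mem_map, List.mem_filter, decide_eq_true_eq]
  push Not
  constructor
  · rintro ⟨_, ⟨r, ⟨hr, hw⟩, rfl⟩, -⟩
    exact ⟨r, hr, hw⟩
  · rintro ⟨r, hr, hw⟩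
    exact ⟨_, ⟨r, ⟨hr, hw⟩, rfl⟩, (hpos r hr).ne'⟩

theorem HasWeightDistribution.hasParameters [Finite F] {C : Submodule F (Fin n → F)}
    {T : List (ℕ × ℕ)} {d k z f : ℕ} (h : HasWeightDistribution C ((0, z) :: (d, f) :: T))
    (hpos : ∀ r ∈ (0, z) :: (d, f) :: T, 0 < r.2) (hd : 0 < d) (hT : ∀ r ∈ T, d ≤ r.1)
    (hk : Module.finrank F C = k) : HasParameters C k d := by
  refine ⟨hk, ?_, ?_⟩
  · obtain ⟨c, hc, hw⟩ := (h.exists_iff hpos d).2 ⟨(d, f), by simp, rfl⟩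
    refine ⟨c, hc, 0, C.zero_mem, ?_, by rw [hammingDist_zero_right, hw]⟩
    rintro rfl
    rw [hammingNorm_zero] at hw
    omega
  · rintro _ ⟨x, hx, y, hy, hxy, rfl⟩
    rw [hammingDist_comm, hammingDist_eq_hammingNorm, neg_add_eq_sub]
    obtain ⟨r, hr, hw⟩ := (h.exists_iff hpos (hammingNorm (x - y))).1 ⟨_, C.sub_mem hx hy, rfl⟩
    rw [← hw]
    simp only [List.mem_cons] at hr
    rcases hr with rfl | rfl | hr
    · exact absurd (hammingNorm_eq_zero.1 hw.symm) (sub_ne_zero.2 hxy)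
    · exact le_rfl
    · exact hT r hr

theorem HasWeightDistribution.ncard_nonzeroWeights [Finite F] {C : Submodule F (Fin n → F)}
    {T : List (ℕ × ℕ)} {z : ℕ} (h : HasWeightDistribution C ((0, z) :: T))
    (hpos : ∀ r ∈ (0, z) :: T, 0 < r.2) (hT : ∀ r ∈ T, r.1 ≠ 0) (hnd : (T.map Prod.fst).Nodup) :
    (nonzeroWeights C).ncard = T.length := by
  have : nonzeroWeights C = ((T.map Prod.fst).toFinset : Set ℕ) := by
    ext w
    rw [nonzeroWeights, Set.mem_ofPred_eq, h.exists_iff hpos]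
    simp only [List.mem_cons, List.coe_toFinset, List.mem_map, Set.mem_ofPred_eq]
    constructor
    · rintro ⟨hw, r, rfl | hr, hrw⟩
      · exact absurd hrw.symm hw
      · exact ⟨r, hr, hrw⟩
    · rintro ⟨r, hr, rfl⟩
      exact ⟨hT r hr, r, .inr hr, rfl⟩
  rw [this, Set.ncard_coe_finset, List.toFinset_card_of_nodup hnd, List.length_map]

theorem hammingNorm_add_card (c : Fin n → F) : hammingNorm c + #{t | c t = 0} = n := by
  rw [add_comm, hammingNorm]
  simpa using card_filter_add_card_filter_not (s := (univ : Finset (Fin n))) (fun t => c t = 0)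

theorem hammingNorm_traceWord_left {K : Type*} [Field K] [Algebra F K] {β : K} {a : F} (ha : a ≠ 0) :
    hammingNorm (traceWord F n β (a, 0)) = n := by
  have : #{t | traceWord F n β (a, 0) t = 0} = 0 := by simp [traceWord, ha]
  have := hammingNorm_add_card (traceWord F n β (a, 0))
  omega

/-! ### Weight distributions of the trace codes. -/

section Distribution
variable {K : Type*} [Field K] [Fintype K] [Algebra F K]

theorem card_nonzero_trace_mul_eq [Fintype F] [DecidableEq K] {b : K} (hb : b ≠ 0) (c : F) :
    #{y : K | y ≠ 0 ∧ Algebra.trace F K (b * y) = c} + (if c = 0 then 1 else 0) =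
      Fintype.card F ^ (Module.finrank F K - 1) := by
  rw [← card_trace_mul_eq hb c, card_filter, card_filter, ← add_sum_erase _ _ (mem_univ 0),
    ← add_sum_erase univ (fun y : K => if Algebra.trace F K (y * b) = c then 1 else 0)
      (mem_univ 0), zero_mul, map_zero, add_comm]
  simp only [ne_eq, not_true_eq_false, false_and, if_false, zero_add, eq_comm (a := (0 : F))]
  congr 1
  refine sum_congr rfl fun y hy => ?_
  simp [(mem_erase.1 hy).1, mul_comm]

/-- If the powers of `β` run `M` times through the nonzero elements of `K`. -/
theorem hammingNorm_traceWord_primitive [Fintype F] {M N : ℕ} {β : K} (hN : Fintype.card K = N + 1)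
    (hβ : IsPrimitiveRoot β N) (a : F) {b : K} (hb : b ≠ 0) :
    hammingNorm (traceWord F (M * N) β (a, b)) +
      M * (Fintype.card F ^ (Module.finrank F K - 1) - if a = 0 then 1 else 0) = M * N := by
  classical
  have h := hammingNorm_add_card (traceWord F (M * N) β (a, b))
  simp only [traceWord_apply_eq_zero_iff] at h
  rw [card_filter_fin_mul (P := fun t => Algebra.trace F K (b * β ^ t) = -a) M N,
    card_filter_pow_primitive (P := fun y => Algebra.trace F K (b * y) = -a) hN hβ] at h
  · have h2 := card_nonzero_trace_mul_eq hb (-a)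
    simp only [neg_eq_zero] at h2
    rw [← h2, Nat.add_sub_cancel]
    exact h
  · intro k l
    rw [pow_add, pow_mul, hβ.pow_eq_one, one_pow, mul_one]

/-- If the powers of `β` are the nonzero squares of `K`. -/
theorem two_mul_hammingNorm_traceWord {β : K} (hchar : ringChar K ≠ 2)
    (hn : Fintype.card K = 2 * n + 1) (hβ : IsPrimitiveRoot β n) (a : F) (b : K) :
    2 * hammingNorm (traceWord F n β (a, b)) + quadCount b (-a) =
      2 * n + if a = 0 then 1 else 0 := by
  classical
  have h := hammingNorm_add_card (traceWord F n β (a, b))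
  simp only [traceWord_apply_eq_zero_iff] at h
  have h2 := two_mul_card_filter_pow_primitive
    (P := fun y => Algebra.trace F K (b * y) = -a) hchar hn hβ
  have h3 : quadCount b (-a) = #{x : K | x ≠ 0 ∧ Algebra.trace F K (b * x ^ 2) = -a} +
      if a = 0 then 1 else 0 := by
    rw [quadCount, card_filter, card_filter, ← add_sum_erase _ _ (mem_univ 0),
      ← add_sum_erase univ
        (fun x : K => if x ≠ 0 ∧ Algebra.trace F K (b * x ^ 2) = -a then 1 else 0) (mem_univ 0)]
    simp only [ne_eq, not_true_eq_false, false_and, if_false, zero_add]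
    rw [add_comm]
    congr 1
    · refine sum_congr rfl fun y hy => ?_
      simp [(mem_erase.1 hy).1]
    · simp [eq_comm]
  omega

/-- A position is a zero when the trace equals `-a`. So `a` gives the smaller weight `w₁` when `-a`
lies in the half with more solutions, and `w₂` otherwise. -/
theorem card_hammingNorm_traceWord_eq [Fintype F] (hodd : Odd (Fintype.card F)) {h : ℕ}
    (hd : Module.finrank F K = 2 * h + 1) {β : K}
    (hn : Fintype.card K = 2 * n + 1) (hβ : IsPrimitiveRoot β n) {b : K} (hb : b ≠ 0)
    {w₁ w₂ w : ℕ} (h1 : 2 * w₁ + (Fintype.card F ^ (2 * h) + Fintype.card F ^ h) = 2 * n)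
    (h2 : 2 * w₂ + Fintype.card F ^ (2 * h) = 2 * n + Fintype.card F ^ h) :
    #{a : F | a ≠ 0 ∧ hammingNorm (traceWord F n β (a, b)) = w} =
      (if w₁ = w then (Fintype.card F - 1) / 2 else 0) +
      (if w₂ = w then (Fintype.card F - 1) / 2 else 0) := by
  have hchar : ringChar K ≠ 2 := by
    rw [← Algebra.ringChar_eq F K]; exact ringChar_ne_two_of_odd hodd
  obtain ⟨S, S', hdisj, hU, hSS, hS, hTS, hTS'⟩ := exists_quadCount_partition hodd hd hb
  have hne : ∀ c, c ∈ S ∪ S' → c ≠ 0 := fun c hc => by rw [hU] at hc; exact (mem_erase.1 hc).1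
  have hw1 : ∀ c ∈ S', hammingNorm (traceWord F n β (-c, b)) = w₁ := by
    intro c hc
    have := two_mul_hammingNorm_traceWord hchar hn hβ (-c) b
    rw [neg_neg, hTS' c hc, if_neg (neg_ne_zero.2 (hne c (mem_union_right _ hc)))] at this
    omega
  have hw2 : ∀ c ∈ S, hammingNorm (traceWord F n β (-c, b)) = w₂ := by
    intro c hc
    have := two_mul_hammingNorm_traceWord hchar hn hβ (-c) b
    rw [neg_neg, if_neg (neg_ne_zero.2 (hne c (mem_union_left _ hc)))] at this
    have h' := hTS c hc
    omega
  have e : #{a : F | a ≠ 0 ∧ hammingNorm (traceWord F n β (a, b)) = w} =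
      #{c ∈ S' ∪ S | hammingNorm (traceWord F n β (-c, b)) = w} := by
    refine card_equiv (Equiv.neg F) fun a => ?_
    rw [union_comm, hU]
    simp
  rw [e, filter_union, card_union_of_disjoint
    (disjoint_filter_filter hdisj.symm), show (Fintype.card F - 1) / 2 = #S by omega]
  congr 1
  · rw [filter_congr (q := fun _ => w₁ = w) fun c hc => by rw [hw1 c hc]]
    split_ifs with hw <;> simp [hw, hSS]
  · rw [filter_congr (q := fun _ => w₂ = w) fun c hc => by rw [hw2 c hc]]
    split_ifs with hw <;> simp [hw]

theorem hasWeightDistribution_range_traceWord_odd [Fintype F] (hodd : Odd (Fintype.card F)) {h : ℕ}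
    (hd : Module.finrank F K = 2 * h + 1) {β : K}
    (hn : Fintype.card K = 2 * n + 1) (hβ : IsPrimitiveRoot β n)
    (hinj : Function.Injective (traceWord F n β)) {w₁ w₂ w₃ : ℕ}
    (h1 : 2 * w₁ + (Fintype.card F ^ (2 * h) + Fintype.card F ^ h) = 2 * n)
    (h2 : 2 * w₂ + Fintype.card F ^ (2 * h) = 2 * n + 1)
    (h3 : 2 * w₃ + Fintype.card F ^ (2 * h) = 2 * n + Fintype.card F ^ h) :
    HasWeightDistribution (LinearMap.range (traceWord F n β))
      [(0, 1), (w₁, (Fintype.card F - 1) * n), (w₂, 2 * n), (w₃, (Fintype.card F - 1) * n),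
        (n, Fintype.card F - 1)] := by
  intro w
  have hchar : ringChar K ≠ 2 := by
    rw [← Algebra.ringChar_eq F K]; exact ringChar_ne_two_of_odd hodd
  rw [weightCount_range hinj, card_filter_prod_eq (n₀ := n) (w₀ := w₂)
    (by rw [show ((0, 0) : F × K) = 0 from rfl, map_zero, hammingNorm_zero])
    (fun a ha => hammingNorm_traceWord_left ha)
    (fun b hb => by
      have := two_mul_hammingNorm_traceWord hchar hn hβ (0 : F) b
      rw [neg_zero, quadCount_zero hodd hd hb, if_pos rfl] at this
      omega)
    (fun b hb => card_hammingNorm_traceWord_eq hodd hd hn hβ hb (w := w) h1 h3), hn,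
    Nat.add_sub_cancel]
  obtain ⟨k, hk⟩ := hodd
  rw [hk, Nat.add_sub_cancel, Nat.mul_div_cancel_left _ two_pos]
  simp only [List.filter_cons, List.filter_nil, decide_eq_true_eq]
  split_ifs <;> simp <;> ring

theorem hasWeightDistribution_range_traceWord_primitive [Fintype F] {M N : ℕ} {β : K} (hn : n = M * N)
    (hN : Fintype.card K = N + 1) (hβ : IsPrimitiveRoot β N)
    (hinj : Function.Injective (traceWord F n β)) {w₁ w₂ : ℕ}
    (h1 : w₁ + M * Fintype.card F ^ (Module.finrank F K - 1) = n)
    (h2 : w₂ + M * (Fintype.card F ^ (Module.finrank F K - 1) - 1) = n) :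
    HasWeightDistribution (LinearMap.range (traceWord F n β))
      [(0, 1), (w₁, (Fintype.card F - 1) * N), (w₂, N), (n, Fintype.card F - 1)] := by
  subst hn
  intro w
  rw [weightCount_range hinj, card_filter_prod_eq (n₀ := M * N) (w₀ := w₂)
    (r := if w₁ = w then Fintype.card F - 1 else 0)
    (by rw [show ((0, 0) : F × K) = 0 from rfl, map_zero, hammingNorm_zero])
    (fun a ha => hammingNorm_traceWord_left ha)
    (fun b hb => by
      have := hammingNorm_traceWord_primitive (M := M) hN hβ (0 : F) hb
      rw [if_pos rfl] at this
      omega)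
    (fun b hb => by
      have : ∀ a : F, (a ≠ 0 ∧ hammingNorm (traceWord F (M * N) β (a, b)) = w) ↔
          (a ≠ 0 ∧ w₁ = w) := fun a => and_congr_right fun ha => by
        have := hammingNorm_traceWord_primitive (M := M) hN hβ a hb
        rw [if_neg ha, Nat.sub_zero] at this
        rw [show hammingNorm (traceWord F (M * N) β (a, b)) = w₁ by omega]
      simp only [this]
      split_ifs with h
      · simp [h, filter_ne']
      · simp [h]), hN, Nat.add_sub_cancel]
  simp only [List.filter_cons, List.filter_nil, decide_eq_true_eq]
  split_ifs <;> simp <;> ring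

end Distribution
end Table

/-! ### The order and the degree of `β`. -/

/-- For `m = 2 * h + 1` the first number is `n - δ₁`, so this gives `β` order `n`. If `d` divides
`(q ^ h + 1) / 2` and `n`, then mod `2 * d` one has `q ^ (2 * h) = 1 = q ^ (2 * h + 1)`, hence `q =
1` and `2 = q ^ h + 1 = 0`. -/
theorem Nat.coprime_half_pow_add_one {q h : ℕ} (hodd : Odd q) :
    Nat.Coprime (q ^ h * ((q ^ h + 1) / 2)) ((q ^ (2 * h + 1) - 1) / 2) := by
  have hq : 0 < q := hodd.pos
  have hN := Nat.two_mul_half_pow_sub_one hodd (2 * h + 1)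
  have hu : 2 * ((q ^ h + 1) / 2) = q ^ h + 1 := by
    obtain ⟨k, hk⟩ := hodd.pow (n := h)
    omega
  generalize (q ^ (2 * h + 1) - 1) / 2 = n at *
  generalize (q ^ h + 1) / 2 = u at *
  have hN' : 2 * n + 1 = q ^ (2 * h + 1) := by
    have := Nat.one_le_pow (2 * h + 1) q hq
    omega
  apply Nat.Coprime.mul_left
  · have h1 : Nat.Coprime (q ^ (2 * h + 1)) n := by
      rw [← hN']; simp
    exact Nat.Coprime.pow_left _ (Nat.Coprime.coprime_dvd_left (dvd_pow_self q (by omega)) h1)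
  · have hd1 : 2 * Nat.gcd u n ∣ q ^ h + 1 := hu ▸ Nat.mul_dvd_mul_left 2 (Nat.gcd_dvd_left u n)
    have hd2 : 2 * Nat.gcd u n ∣ 2 * n := Nat.mul_dvd_mul_left 2 (Nat.gcd_dvd_right u n)
    zify at hd1 hd2 hN'
    have h1 : (2 * (Nat.gcd u n : ℕ) : ℤ) ∣ q - 1 := by
      have e : ((q : ℤ) - 1) = 2 * n - (q ^ h + 1) * ((q ^ h - 1) * q) := by
        have : (2 * n : ℤ) = q ^ (2 * h + 1) - 1 := by linear_combination hN'
        rw [this]; ring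
      rw [e]
      exact _root_.dvd_sub hd2 (hd1.mul_right _)
    have h2 : (2 * (Nat.gcd u n : ℕ) : ℤ) ∣ 2 := by
      have h3 : (2 * (Nat.gcd u n : ℕ) : ℤ) ∣ q ^ h - 1 :=
        h1.trans (by simpa using sub_dvd_pow_sub_pow (q : ℤ) 1 h)
      have := _root_.dvd_sub hd1 h3
      ring_nf at this ⊢
      exact this
    have h4 : 2 * Nat.gcd u n ∣ 2 := by exact_mod_cast h2
    have := Nat.le_of_dvd two_pos h4
    have h5 : 0 < Nat.gcd u n := Nat.pos_of_ne_zero fun h0 => by simp [h0] at h4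
    rw [Nat.Coprime]; omega

section
variable {F : Type*} [Field F]

/-- The `q ^ h`-power Frobenius, with `q = |F|`, fixes `β` and hence all of `K`, so `K` has at most
`q ^ h` elements; the order of `β` gives the reverse bound. -/
theorem finrank_eq_of_isPrimitiveRoot_card_sub_one [Fintype F] {K : Type*} [Field K] [Fintype K]
    [Algebra F K] {β : K} (hgen : Algebra.adjoin F {β} = ⊤) {h : ℕ} (hh : 0 < h)
    (hβ : IsPrimitiveRoot β (Fintype.card F ^ h - 1)) : Module.finrank F K = h := by
  have hq : 1 < Fintype.card F := Fintype.one_lt_card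
  have hK := Module.card_eq_pow_finrank (K := F) (V := K)
  have h1 : 1 < Fintype.card F ^ h := Nat.one_lt_pow (by omega) hq
  have hβ0 : β ≠ 0 := hβ.ne_zero (by omega)
  apply le_antisymm
  · by_contra! hlt
    have hfix : ∀ y : K, eval y (X ^ Fintype.card F ^ h - X : K[X]) = 0 := by
      intro y
      have hy : y ∈ Algebra.adjoin F {β} := by rw [hgen]; trivial
      rw [Algebra.adjoin_singleton_eq_range_aeval] at hy
      obtain ⟨p, rfl⟩ := hy
      have hb : β ^ Fintype.card F ^ h = β := by
        rw [← Nat.sub_add_cancel h1.le, pow_succ, hβ.pow_eq_one, one_mul]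
      change eval (aeval β p) _ = 0
      rw [eval_sub, eval_pow, eval_X, ← aeval_pow_card_pow, hb, sub_self]
    refine FiniteField.X_pow_card_pow_sub_X_ne_zero K hh.ne' hq
      (eq_zero_of_natDegree_lt_card_of_eval_eq_zero _ Function.injective_id hfix ?_)
    rw [FiniteField.X_pow_card_pow_sub_X_natDegree_eq K hh.ne' hq, hK]
    exact Nat.pow_lt_pow_right hq hlt
  · have hdvd := hβ.dvd_of_pow_eq_one _ (FiniteField.pow_card_sub_one_eq_one β hβ0)
    have := Fintype.one_lt_card (α := K)
    have := Nat.le_of_dvd (by omega) hdvd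
    rw [hK] at this
    exact (Nat.pow_le_pow_iff_right hq).1 (by omega)

/-- The order of `β` is at least `q ^ (m - 1)`, where `q = |F| ≥ 3`, which is too large for a field
of degree below `m`. -/
theorem finrank_eq_of_isPrimitiveRoot_half [Fintype F] {E : Type*} [Field E] [Algebra F E]
    [FiniteDimensional F E] {K : IntermediateField F E} {β : K} {m : ℕ} (hm : 2 ≤ m)
    (hodd : Odd (Fintype.card F))
    (hβ : IsPrimitiveRoot β ((Fintype.card F ^ m - 1) / 2)) (hE : Module.finrank F E = m) :
    Module.finrank F K = m := by
  have : Finite E := Module.finite_of_finite F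
  have : Fintype K := Fintype.ofFinite K
  have hq3 : 3 ≤ Fintype.card F := by
    have := Fintype.one_lt_card (α := F)
    obtain ⟨k, hk⟩ := hodd
    omega
  have hK := Module.card_eq_pow_finrank (K := F) (V := K)
  have hpm : Fintype.card F ^ m = Fintype.card F ^ (m - 1) * Fintype.card F := by
    rw [← pow_succ]; congr 1; omega
  have hmul := Nat.mul_le_mul_left (Fintype.card F ^ (m - 1)) hq3
  have hpos : 0 < Fintype.card F ^ (m - 1) := by positivity
  have hβ0 : β ≠ 0 := hβ.ne_zero (by omega)
  apply le_antisymm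
  · rw [← hE]
    exact Submodule.finrank_le (Subalgebra.toSubmodule K.toSubalgebra)
  · have hdvd := hβ.dvd_of_pow_eq_one _ (FiniteField.pow_card_sub_one_eq_one β hβ0)
    have := Fintype.one_lt_card (α := K)
    have := Nat.le_of_dvd (by omega) hdvd
    rw [hK] at this
    have := (Nat.pow_lt_pow_iff_right (a := Fintype.card F) (n := m - 1)
      (m := Module.finrank F K) (by omega)).1 (by omega)
    omega

theorem adjoin_gen_eq_top {E : Type*} [Field E] [Algebra F E] [FiniteDimensional F E] (x : E) :
    Algebra.adjoin F {IntermediateField.AdjoinSimple.gen F x} = ⊤ := by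
  have hx : IsIntegral F x := .of_finite F x
  rw [← IntermediateField.adjoin.powerBasis_gen hx]
  exact PowerBasis.adjoin_gen_eq_top _

theorem IsPrimitiveRoot.gen {E : Type*} [Field E] [Algebra F E] {x : E} {N : ℕ}
    (hx : IsPrimitiveRoot x N) : IsPrimitiveRoot (IntermediateField.AdjoinSimple.gen F x) N := by
  apply IsPrimitiveRoot.of_map_of_injective (f := algebraMap (IntermediateField.adjoin F {x}) E)
  · rwa [IntermediateField.AdjoinSimple.algebraMap_gen]
  · exact FaithfulSMul.algebraMap_injective _ _

theorem natCast_ne_zero_of_two_mul_add_one [Fintype F] {n m : ℕ} (hm : m ≠ 0)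
    (hn : 2 * n + 1 = Fintype.card F ^ m) : (n : F) ≠ 0 := by
  intro h0
  have := congrArg (Nat.cast : ℕ → F) hn
  simp [h0, hm] at this

end

/-! ### The two parities of `m`. -/

theorem theorem5 {F E : Type*} [Field F] [Fintype F] [DecidableEq F] [Field E] [Algebra F E]
    (q m : ℕ) (hq : Fintype.card F = q) (hodd : Odd q) (hm : 2 ≤ m)
    (hE : Module.finrank F E = m) (α : E) (hα : IsPrimitiveRoot α (q ^ m - 1))
    (δ₁ : ℕ) (hδ : IsGreatest (cosetLeaders q ((q ^ m - 1) / 2)) δ₁) :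
    δ₁ = (q ^ m - 1 - q ^ (m - 1) - q ^ ((m - 1) / 2)) / 2 ∧
    (Odd m →
      HasParameters (n := (q ^ m - 1) / 2) (narrowBCHCode F α q m 2 δ₁) (m + 1) δ₁ ∧
      (nonzeroWeights (narrowBCHCode F α q m 2 δ₁)).ncard = 4 ∧
      HasWeightDistribution (narrowBCHCode F α q m 2 δ₁)
        [(0, 1),
         ((q ^ m - q ^ (m - 1) - q ^ ((m - 1) / 2) - 1) / 2, (q - 1) * (q ^ m - 1) / 2),
         ((q ^ m - q ^ (m - 1)) / 2, q ^ m - 1),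
         ((q ^ m - q ^ (m - 1) + q ^ ((m - 1) / 2) - 1) / 2, (q - 1) * (q ^ m - 1) / 2),
         ((q ^ m - 1) / 2, q - 1)]) ∧
    (Even m →
      HasParameters (n := (q ^ m - 1) / 2) (narrowBCHCode F α q m 2 δ₁) (m / 2 + 1) δ₁ ∧
      (4 ≤ m → (nonzeroWeights (narrowBCHCode F α q m 2 δ₁)).ncard = 3) ∧
      HasWeightDistribution (narrowBCHCode F α q m 2 δ₁)
        [(0, 1),
         ((q ^ m - q ^ (m - 1) - q ^ (m / 2 - 1) - 1) / 2, (q - 1) * (q ^ (m / 2) - 1)),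
         ((q - 1) * (q ^ (m - 1) + q ^ (m / 2 - 1)) / 2, q ^ (m / 2) - 1),
         ((q ^ m - 1) / 2, q - 1)]) := by
  have hq3 : 3 ≤ q := by
    have := Fintype.one_lt_card (α := F)
    obtain ⟨k, hk⟩ := hodd
    omega
  have hδeq := two_mul_largest_cosetLeader hq3 hodd hm hδ
  refine ⟨by omega, ?_⟩
  have hN := Nat.two_mul_half_pow_sub_one hodd m
  have hlt := pow_sub_one_add_pow_lt hq3 hm
  have hn1 : 2 * ((q ^ m - 1) / 2) + 1 = q ^ m := by omega
  have : FiniteDimensional F E := Module.finite_of_finrank_pos (by omega)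
  have : Finite E := Module.finite_of_finite F
  have hθ : IsPrimitiveRoot (α ^ 2) ((q ^ m - 1) / 2) := hα.pow (by omega) hN.symm
  subst hq
  -- This is `θ ^ (-δ₁)`, written with a natural exponent.
  set β : E := (α ^ 2) ^ ((Fintype.card F ^ m - 1) / 2 - δ₁) with hβdef
  set K := IntermediateField.adjoin F {β}
  set γ : K := IntermediateField.AdjoinSimple.gen F β
  have : Fintype K := Fintype.ofFinite K
  have hgen : Algebra.adjoin F {γ} = ⊤ := adjoin_gen_eq_top β
  have hβδ : algebraMap K E γ * (α ^ 2) ^ δ₁ = 1 := by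
    rw [IntermediateField.AdjoinSimple.algebraMap_gen, hβdef, ← pow_add,
      Nat.sub_add_cancel (by omega), hθ.pow_eq_one]
  have hδ0 : 0 < δ₁ := by omega
  obtain ⟨hrange, hinj⟩ := range_traceWord hθ hβδ hgen
    (natCast_ne_zero_of_two_mul_add_one (by omega) hn1) hδ0 hδ
  have hcode : narrowBCHCode F α (Fintype.card F) m 2 δ₁ =
      LinearMap.range (traceWord F ((Fintype.card F ^ m - 1) / 2) γ) := hrange.symm
  have hdim : Module.finrank F (LinearMap.range
      (traceWord F ((Fintype.card F ^ m - 1) / 2) γ)) = Module.finrank F K + 1 := by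
    rw [LinearMap.finrank_range_of_inj hinj, Module.finrank_prod, Module.finrank_self, add_comm]
  rw [hcode]
  constructor
  · rintro ⟨h, rfl⟩
    rw [show (2 * h + 1 - 1) / 2 = h by omega] at *
    simp only [Nat.add_sub_cancel] at *
    have hβn : IsPrimitiveRoot β ((Fintype.card F ^ (2 * h + 1) - 1) / 2) := by
      refine hθ.pow_of_coprime _ ?_
      convert Nat.coprime_half_pow_add_one (h := h) hodd using 1
      have e : 2 * (Fintype.card F ^ h * ((Fintype.card F ^ h + 1) / 2)) =
          Fintype.card F ^ (2 * h) + Fintype.card F ^ h := by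
        obtain ⟨k, hk⟩ := hodd.pow (n := h)
        have : (Fintype.card F ^ h + 1) / 2 = k + 1 := by omega
        rw [this, two_mul h, pow_add, hk]; ring
      omega
    have hd : Module.finrank F K = 2 * h + 1 :=
      finrank_eq_of_isPrimitiveRoot_half hm hodd (K := K) hβn.gen hE
    have hcard : Fintype.card K = 2 * ((Fintype.card F ^ (2 * h + 1) - 1) / 2) + 1 := by
      rw [Module.card_eq_pow_finrank (K := F), hd, hn1]
    obtain ⟨k₀, hk₀⟩ := hodd.pow (n := h)
    obtain ⟨k₁, hk₁⟩ := hodd.pow (n := 2 * h)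
    have hwd := hasWeightDistribution_range_traceWord_odd hodd hd hcard hβn.gen hinj
      (w₁ := (Fintype.card F ^ (2 * h + 1) - Fintype.card F ^ (2 * h) - Fintype.card F ^ h - 1) / 2)
      (w₂ := (Fintype.card F ^ (2 * h + 1) - Fintype.card F ^ (2 * h)) / 2)
      (w₃ := (Fintype.card F ^ (2 * h + 1) - Fintype.card F ^ (2 * h) + Fintype.card F ^ h - 1) / 2)
      (by omega) (by omega) (by omega)
    rw [show (Fintype.card F - 1) * ((Fintype.card F ^ (2 * h + 1) - 1) / 2) =
      (Fintype.card F - 1) * (Fintype.card F ^ (2 * h + 1) - 1) / 2 from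
      (Nat.mul_div_assoc _ (Dvd.intro _ hN)).symm, hN] at hwd
    have hpos1 : 0 < (Fintype.card F - 1) * (Fintype.card F ^ (2 * h + 1) - 1) / 2 := by
      rw [Nat.mul_div_assoc _ (Dvd.intro _ hN)]
      exact Nat.mul_pos (by omega) (by omega)
    have hQ3 : Fintype.card F ≤ Fintype.card F ^ h := Nat.le_self_pow (by omega) _
    have hQ : Fintype.card F ^ h * 3 ≤ Fintype.card F ^ (2 * h) := by
      rw [two_mul, pow_add]
      exact Nat.mul_le_mul_left _ (by omega)
    have hδw : δ₁ = (Fintype.card F ^ (2 * h + 1) - Fintype.card F ^ (2 * h) -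
      Fintype.card F ^ h - 1) / 2 := by omega
    refine ⟨?_, ?_, hwd⟩
    · rw [hδw]
      refine hwd.hasParameters ?_ (by omega) ?_ (by rw [hdim, hd])
      · simp only [List.forall_mem_cons]
        refine ⟨one_pos, hpos1, by omega, hpos1, by omega, by simp⟩
      · simp only [List.forall_mem_cons]
        refine ⟨by omega, by omega, by omega, by simp⟩
    · refine hwd.ncard_nonzeroWeights ?_ ?_ ?_
      · simp only [List.forall_mem_cons]
        refine ⟨one_pos, hpos1, by omega, hpos1, by omega, by simp⟩
      · simp only [List.forall_mem_cons]
        refine ⟨by omega, by omega, by omega, by omega, by simp⟩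
      · simp only [List.map_cons, List.map_nil, List.nodup_cons, List.mem_cons, List.not_mem_nil,
          or_false, not_false_eq_true, List.nodup_nil, and_true]
        omega
  · intro hev
    obtain ⟨g, rfl⟩ : ∃ g, m = 2 * g + 2 := by
      obtain ⟨k, rfl⟩ := hev
      exact ⟨k - 1, by omega⟩
    rw [show (2 * g + 2 - 1) / 2 = g by omega] at *
    rw [show (2 * g + 2) / 2 = g + 1 by omega]
    simp only [show 2 * g + 2 - 1 = 2 * g + 1 by omega, Nat.add_sub_cancel] at *
    -- With `N = q ^ (m / 2) - 1` and `M = (q ^ (m / 2) + 1) / 2`, the length is `M * N`.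
    obtain ⟨M, hM⟩ : ∃ M, Fintype.card F ^ (g + 1) + 1 = 2 * M := by
      obtain ⟨k, hk⟩ := hodd.pow (n := g + 1)
      exact ⟨k + 1, by omega⟩
    have hQ1 : 3 ≤ Fintype.card F ^ (g + 1) :=
      hq3.trans (Nat.le_self_pow (by omega) _)
    obtain ⟨N, hNQ⟩ : ∃ N, Fintype.card F ^ (g + 1) = N + 1 :=
      ⟨_, (Nat.sub_add_cancel (by omega)).symm⟩
    have hg0 : 0 < Fintype.card F ^ g := by positivity
    have hpow1 : Fintype.card F ^ (2 * g + 1) = (N + 1) * Fintype.card F ^ g := by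
      rw [← hNQ, ← pow_add]; congr 1; omega
    have hpow2 : Fintype.card F ^ (2 * g + 2) = (N + 1) * (N + 1) := by
      rw [← hNQ, ← pow_add]; congr 1; omega
    have hNM : N + 2 = 2 * M := by omega
    have hnMN : (Fintype.card F ^ (2 * g + 2) - 1) / 2 = M * N := by
      have : 2 * (M * N) + 1 = (N + 1) * (N + 1) := by
        rw [← mul_assoc, ← hNM]; ring
      omega
    have hMP : 2 * (M * Fintype.card F ^ g) = (N + 1) * Fintype.card F ^ g + Fintype.card F ^ g := by
      rw [← mul_assoc, ← hNM]; ring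
    -- Here `n - δ₁ = M * q ^ g`, so `β` is the `q ^ g`-th power of `θ ^ M`, which has order `N`,
    -- prime to `q`.
    have hβn : IsPrimitiveRoot β N := by
      have e : (Fintype.card F ^ (2 * g + 2) - 1) / 2 - δ₁ = M * Fintype.card F ^ g := by omega
      rw [hβdef, e, pow_mul]
      refine (hθ.pow (by omega) hnMN).pow_of_coprime _ (Nat.Coprime.pow_left _ ?_)
      have : Nat.Coprime (Fintype.card F ^ (g + 1)) N := by rw [hNQ]; simp
      exact this.coprime_dvd_left (dvd_pow_self _ (by omega))
    have hd : Module.finrank F K = g + 1 :=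
      finrank_eq_of_isPrimitiveRoot_card_sub_one hgen (by omega)
        (by rw [hNQ, Nat.add_sub_cancel]; exact hβn.gen)
    have hcard : Fintype.card K = N + 1 := by
      rw [Module.card_eq_pow_finrank (K := F), hd, hNQ]
    have hw2 : (Fintype.card F - 1) * (Fintype.card F ^ (2 * g + 1) + Fintype.card F ^ g) / 2 +
        M * (Fintype.card F ^ g - 1) = M * N := by
      obtain ⟨r, hr⟩ : ∃ r, Fintype.card F = r + 1 := ⟨_, (Nat.sub_add_cancel (by omega)).symm⟩
      obtain ⟨P, hP⟩ : ∃ P, Fintype.card F ^ g = P + 1 := ⟨_, (Nat.sub_add_cancel hg0).symm⟩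
      rw [hpow1, ← hMP, mul_left_comm, Nat.mul_div_cancel_left _ two_pos, hP, Nat.add_sub_cancel, hr,
        Nat.add_sub_cancel]
      have : N = r * (P + 1) + P := by
        have : N + 1 = (P + 1) * (r + 1) := by rw [← hNQ, pow_succ, hP, hr]
        linarith
      rw [this]; ring
    have hwd := hasWeightDistribution_range_traceWord_primitive hnMN hcard hβn.gen hinj
      (w₁ := (Fintype.card F ^ (2 * g + 2) - Fintype.card F ^ (2 * g + 1) -
        Fintype.card F ^ g - 1) / 2)
      (w₂ := (Fintype.card F - 1) * (Fintype.card F ^ (2 * g + 1) + Fintype.card F ^ g) / 2)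
      (by rw [hd, Nat.add_sub_cancel]; omega) (by rw [hd, Nat.add_sub_cancel, hnMN, hw2])
    rw [show N = Fintype.card F ^ (g + 1) - 1 by omega] at hwd
    have hδw : δ₁ = (Fintype.card F ^ (2 * g + 2) - Fintype.card F ^ (2 * g + 1) -
        Fintype.card F ^ g - 1) / 2 := by omega
    have hpos1 : 0 < (Fintype.card F - 1) * (Fintype.card F ^ (g + 1) - 1) :=
      Nat.mul_pos (by omega) (by omega)
    have hMpos : 1 ≤ M := by omega
    have hMsub : M * (Fintype.card F ^ g - 1) + M = M * Fintype.card F ^ g := by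
      rw [← Nat.mul_succ, Nat.succ_eq_add_one, Nat.sub_add_cancel hg0]
    refine ⟨?_, fun h4 => ?_, hwd⟩
    · rw [hδw]
      refine hwd.hasParameters ?_ (by omega) ?_ (by rw [hdim, hd])
      · simp only [List.forall_mem_cons]
        refine ⟨one_pos, hpos1, by omega, by omega, by simp⟩
      · simp only [List.forall_mem_cons]
        refine ⟨by omega, by omega, by simp⟩
    · have hP3 : Fintype.card F ≤ Fintype.card F ^ g := Nat.le_self_pow (by omega) _
      have hMM : M * 1 ≤ M * (Fintype.card F ^ g - 1) := Nat.mul_le_mul_left _ (by omega)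
      refine hwd.ncard_nonzeroWeights ?_ ?_ ?_
      · simp only [List.forall_mem_cons]
        refine ⟨one_pos, hpos1, by omega, by omega, by simp⟩
      · simp only [List.forall_mem_cons]
        refine ⟨by omega, by omega, by omega, by simp⟩
      · simp only [List.map_cons, List.map_nil, List.nodup_cons, List.mem_cons, List.not_mem_nil,
          or_false, not_false_eq_true, List.nodup_nil, and_true]
        omega
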